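/- \textbf{Setting.} Let $(\varepsilon_k)_{k\in\mathbb Z}$ be i.i.d.\ random elements of a measurable space $\mathbb S$, and let $g_h:\mathbb S^{\mathbb N}\to\mathbb R$, $h\ge 1$, be measurable maps such that $U_{k,h}=g_h(\varepsilon_k,\varepsilon_{k-1},\dots)$ is integrable with $E[U_{k,h}]=0$. For sample size $n$ one observes $X_{k,h}=\mu_{k,h}+U_{k,h}$, $1\le k\le n$, $1\le h\le d=d_n$, where the means $\mu_{k,h}$ may depend on $n$. For arrays $(c_h)$ write $\sup_h^*c_h=\limsup_{d\to\infty}\max_{h\le d}c_h$ and $\inf_h^*c_h=\liminf_{d\to\infty}\min_{h\le d}c_h$. With an independent copy $(\varepsilon_k')$ of $(\varepsilon_k)$ and $\|\cdot\|_p=E[|\cdot|^p]^{1/p}$, let $$a_k(p)=\sup_h^*\bigl\|g_h(\varepsilon_k,\dots,\varepsilon_0,\varepsilon_{-1},\dots)-g_h(\varepsilon_k,\dots,\varepsilon_0',\varepsilon_{-1},\dots)\bigr\|_p ,\qquad k\ge 0,$$ and let $\sigma_h\ge0$ with $\sigma_h^2=\lim_n n^{-1}E\bigl[\sum_{k,l=1}^nU_{k,h}U_{l,h}\bigr]$.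 \textbf{Assumption 1.} $p>4$, $a_k(p)\le A\max(k,1)^{-\mathfrak a}$ for all $k\ge0$, with constants $\mathfrak a>5/2$ and $A>0$, and $\inf_h^*\sigma_h\ge\sigma^-$ for some $\sigma^->0$. \textbf{Alternative.} For each coordinate $h$ (and $n$) let $\tau_h$ be a change fraction and $k_h^*=\lfloor\tau_hn\rfloor$. Let $\mathcal S_d^c$ be the set of $h\le d$ for which $\tau_h\in(0,1)$, $1\le k_h^*<n$ and $\mu_{1,h}=\dots=\mu_{k_h^*,h}\ne\mu_{k_h^*+1,h}=\dots=\mu_{n,h}$. The alternative $\mathcal H_A^{(\Delta\mu)}$ holds for sample size $n$ if $\mathcal S_d^c\neq\emptyset$ and $\mu_{1,h}=\dots=\mu_{n,h}$ for all remaining $h\le d$; then $\Delta\mu=\Delta\mu(n)=\min_{h\in\mathcal S_d^c}|\mu_{k_h^*,h}-\mu_{k_h^*+1,h}|$. \textbf{Estimators.} For $0<\mathfrak t\le 1/2$ let $\widehat\tau_h(\mathfrak t)$ be any choice of $$\widehat\tau_h(\mathfrak t)\in\operatorname*{arg\,max}_{t\in(\mathfrak t,1-\mathfrak t)}\; n^{-1/2}\Bigl|\sum_{j=1}^{\lceil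 nt\rceil}X_{j,h}-\frac{\lceil nt\rceil}{n}\sum_{j=1}^nX_{j,h}\Bigr| .$$ \textbf{Theorem.} Let $p>4$, $\mathfrak a>5/2$, $A>0$, $0<\mathfrak t\le1/2$. There is a constant $C_a>0$ depending only on $(p,\mathfrak a,A,\mathfrak t)$, and for every $D>0$ a constant $C>0$ depending only on $(p,\mathfrak a,A,\mathfrak t,D)$, such that the following holds for every model as above satisfying Assumption 1 and every $n_1\ge2$. Assume that for all $n\ge n_1$ the alternative $\mathcal H_A^{(\Delta\mu)}$ holds and $\mathfrak t<\inf_{h\in\mathcal S_d^c}\tau_h\le\sup_{h\in\mathcal S_d^c}\tau_h<1-\mathfrak t$, and that $\Delta\mu(n)$, $n\ge n_1$, is monotone decreasing with $\Delta\mu(n_1)\le D$. (i) For all $n\ge n_1$ and all $x\ge C_a\dfrac{\log n}{(\Delta\mu)^2n}$, $$P\Bigl(\max_{h\in\mathcal S_d^c}|\widehat\tau_h(\mathfrak t)-\tau_h|\ge x\Bigr)\le C\,|\mathcal S_d^c|\,(x\,n\log n)^{-p/2+2}.$$ (ii) If in addition $d_n=O(n^{\mathfrak d})$ with $0<\mathfrak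 d<p/2-2$, and $\lim_{n\to\infty}\frac{\log n}{(\Delta\mu)^2n}=0$, then $\max_{h\in\mathcal S_d^c}|\widehat\tau_h(\mathfrak t)-\tau_h|\to0$ in probability as $n\to\infty$. (If the maximum is not measurable, $P$ is read as outer probability.) -/

import Mathlib

open MeasureTheory ProbabilityTheory Filter Topology
open scoped ENNReal NNReal

noncomputable section

/-- `sup_h^* c_h = limsup_{d → ∞} max_{h < d} c_h` for an array `c d h`. -/
def supStar {α : Type*} [CompleteLattice α] (c : ℕ → ℕ → α) : α :=
  limsup (fun d : ℕ => ⨆ h : Fin d, c d h) atTop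

/-- `inf_h^* c_h = liminf_{d → ∞} min_{h < d} c_h` for an array `c d h`. -/
def infStar {α : Type*} [CompleteLattice α] (c : ℕ → ℕ → α) : α :=
  liminf (fun d : ℕ => ⨅ h : Fin d, c d h) atTop

/-- The causal past `(ε_k, ε_{k-1}, ε_{k-2}, …)` of a two-sided sequence. -/
def past {𝕊 : Type*} (e : ℤ → 𝕊) (k : ℤ) : ℕ → 𝕊 := fun j => e (k - j)

/-- The data of the change point model. Coordinates are numbered `0, 1, …`; for sample size `n` the
observed coordinates are those with `h < dim n`, and the observation times are `k = 1, …, n`. -/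
structure ChangePointModel (Ω 𝕊 : Type*) where
  /-- the innovations `ε_k`, `k ∈ ℤ` -/
  innov : ℤ → Ω → 𝕊
  /-- the maps `g_h` -/
  g : ℕ → (ℕ → 𝕊) → ℝ
  /-- the mean `μ_{k,h}` for sample size `n`, as `mean n k h` -/
  mean : ℕ → ℕ → ℕ → ℝ
  /-- the dimension `d = d_n` -/
  dim : ℕ → ℕ
  /-- the change fraction `τ_h` for sample size `n`, as `frac n h` -/
  frac : ℕ → ℕ → ℝ

namespace ChangePointModel

variable {Ω 𝕊 : Type*} (M : ChangePointModel Ω 𝕊)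

/-- The centred process `U_{k,h} = g_h(ε_k, ε_{k-1}, …)`. -/
def noise (k : ℤ) (h : ℕ) (ω : Ω) : ℝ := M.g h (past (fun i => M.innov i ω) k)

/-- The observation `X_{k,h} = μ_{k,h} + U_{k,h}` for sample size `n`. -/
def obs (n k h : ℕ) (ω : Ω) : ℝ := M.mean n k h + M.noise k h ω

/-- The `ε_k` are i.i.d., the `g_h` are measurable, and the noise has an expectation, equal to zero
(so that `mean n k h` is the expectation of the observation `obs n k h`). -/
structure IsRegular [MeasurableSpace Ω] [MeasurableSpace 𝕊] (P : Measure Ω) : Prop where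
  measurable_innov : ∀ k, Measurable (M.innov k)
  indep : iIndepFun M.innov P
  identDistrib : ∀ k, IdentDistrib (M.innov k) (M.innov 0) P P
  measurable_g : ∀ h, Measurable (M.g h)
  integrable : ∀ k h, Integrable (M.noise k h) P
  centered : ∀ k h, ∫ ω, M.noise k h ω ∂P = 0

/-- The temporal dependence measure
`a_k(p) = sup_h^* ‖g_h(ε_k, …, ε_0, ε_{-1}, …) - g_h(ε_k, …, ε_0', ε_{-1}, …)‖_p`.
The independent copy `ε'` of `ε` is realised on the second factor of `Ω × Ω`. -/
def depMeasure [MeasurableSpace Ω] (P : Measure Ω) (p : ℝ) (k : ℕ) : ℝ≥0∞ :=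
  supStar fun _ h => eLpNorm
    (fun w : Ω × Ω =>
      M.g h (past (fun i => M.innov i w.1) k) -
        M.g h (past (fun i => if i = 0 then M.innov 0 w.2 else M.innov i w.1) k))
    (ENNReal.ofReal p) (P.prod P)

/-- The long run covariance `γ_{i,j} = lim_n n⁻¹ E[∑_{k ≤ n} ∑_{l ≤ n} U_{k,i} U_{l,j}]`. -/
def longRunCov [MeasurableSpace Ω] (P : Measure Ω) (i j : ℕ) : ℝ :=
  limUnder atTop fun n : ℕ =>
    (n : ℝ)⁻¹ * ∫ ω, ∑ k ∈ Finset.Icc 1 n, ∑ l ∈ Finset.Icc 1 n,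
      M.noise k i ω * M.noise l j ω ∂P

/-- The long run standard deviation `σ_h = γ_{h,h}^{1/2}`. -/
def longRunSD [MeasurableSpace Ω] (P : Measure Ω) (h : ℕ) : ℝ := √(M.longRunCov P h h)

/-- The temporal assumptions with moment `p`, decay exponent `𝔞` and constant `A`:
`a_k(p) ≤ A k^{-𝔞}` for `k ≥ 1`, `a_0(p) ≤ A`, and `inf_h^* σ_h ≥ σ⁻` for some `σ⁻ > 0`. -/
structure TemporalAssumptions [MeasurableSpace Ω] (P : Measure Ω) (p 𝔞 A : ℝ) : Prop where
  decay : ∀ k : ℕ, M.depMeasure P p k ≤ ENNReal.ofReal (A * (max (k : ℝ) 1) ^ (-𝔞))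
  nondegenerate : ∃ σm : ℝ, 0 < σm ∧
    (σm : EReal) ≤ infStar fun _ h => ((M.longRunSD P h : ℝ) : EReal)

/-- The time lag of the change, `k_h^* = ⌊τ_h n⌋`. -/
def changeTime (n h : ℕ) : ℕ := ⌊M.frac n h * n⌋₊

/-- `H_{0,h}`: the mean of coordinate `h` is constant over `1, …, n`. -/
def NullAt (n h : ℕ) : Prop :=
  ∀ k ∈ Finset.Icc 1 n, ∀ l ∈ Finset.Icc 1 n, M.mean n k h = M.mean n l h

/-- `H_{A,h}`: `μ_{1,h} = ⋯ = μ_{k*,h} ≠ μ_{k*+1,h} = ⋯ = μ_{n,h}` with `k* = ⌊τ_h n⌋`,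
`τ_h ∈ (0,1)`, both segments being nonempty. -/
def ChangeAt (n h : ℕ) : Prop :=
  0 < M.frac n h ∧ M.frac n h < 1 ∧
  1 ≤ M.changeTime n h ∧ M.changeTime n h < n ∧
  (∀ k ∈ Finset.Icc 1 (M.changeTime n h), M.mean n k h = M.mean n (M.changeTime n h) h) ∧
  (∀ k ∈ Finset.Icc (M.changeTime n h + 1) n,
    M.mean n k h = M.mean n (M.changeTime n h + 1) h) ∧
  M.mean n (M.changeTime n h) h ≠ M.mean n (M.changeTime n h + 1) h

open Classical in
/-- `S_d^c`: the coordinates where a change has occurred. -/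
def changeSet (n : ℕ) : Finset ℕ := (Finset.range (M.dim n)).filter (M.ChangeAt n)

/-- `Δμ_h = |μ_{k*,h} - μ_{k*+1,h}|`. -/
def jump (n h : ℕ) : ℝ :=
  |M.mean n (M.changeTime n h) h - M.mean n (M.changeTime n h + 1) h|

/-- The minimal size of the change, `Δμ = min_{h ∈ S_d^c} Δμ_h`. -/
def minJump (n : ℕ) : ℝ := ⨅ h : M.changeSet n, M.jump n h

/-- `H_A` for sample size `n`: at least one coordinate has a change, and the null hypothesis holds
in all the unaffected coordinates. -/
def Alternative (n : ℕ) : Prop :=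
  (M.changeSet n).Nonempty ∧ ∀ h < M.dim n, M.NullAt n h ∨ M.ChangeAt n h

/-- `n^{-1/2} |∑_{j ≤ ⌈nt⌉} X_{j,h} - (⌈nt⌉ / n) ∑_{j ≤ n} X_{j,h}|`. -/
def cusum (n h : ℕ) (ω : Ω) (t : ℝ) : ℝ :=
  (n : ℝ) ^ (-(1 / 2) : ℝ) *
    |∑ j ∈ Finset.Icc 1 ⌈n * t⌉₊, M.obs n j h ω -
      (⌈n * t⌉₊ : ℝ) / n * ∑ j ∈ Finset.Icc 1 n, M.obs n j h ω|

/-- `s` is a value of `argmax_{t ∈ (𝔱, 1 - 𝔱)}` of the CUSUM function of coordinate `h`. -/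
def IsArgmaxCusum (𝔱 : ℝ) (n h : ℕ) (ω : Ω) (s : ℝ) : Prop :=
  s ∈ Set.Ioo 𝔱 (1 - 𝔱) ∧ IsMaxOn (M.cusum n h ω) (Set.Ioo 𝔱 (1 - 𝔱)) s

/-- `max_{h ∈ S_d^c} |τ̂_h - τ_h|`. -/
def maxError (τhat : ℕ → ℕ → Ω → ℝ) (n : ℕ) (ω : Ω) : ℝ :=
  ⨆ h : M.changeSet n, |τhat n h ω - M.frac n h|

end ChangePointModel

end

/-! With `k = ⌈nt⌉` and noise partial sums `S`, the CUSUM is `n^{-1/2} |d · tent(k) + S_k - (k/n)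
S_n|`, where `d` is the signed jump and the tent peaks at the change time and falls off linearly on
both sides. If the maximiser lies at distance `L` from `k' = ⌈nτ⌉`, the lost drift of order `|d| L`
must be paid by noise: either `|S_k - S_{k'}|` is of order `|d| L`, or `|S_n|` or `|S_{k'}|` is of
order `|d| n` (`noise_large_of_cusum_le`).

No maximal inequality is needed. A Fuk–Nagaev bound for one increment of length `m`
(`exists_fukNagaev_noiseSum`) has a polynomial part `m / y^p` and a Gaussian part. At `y = rm`, with
`r` of order `Δμ`, the polynomial parts `r^{-p} m^{1-p}` sum over `m ≥ X/2`, `X = nx`, to order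
`r^{-p} X^{2-p}`; since `r² X` is at least a multiple of `log n`, this is at most a constant times
`(X log n)^{2-p/2}`. The lower bound on `x` makes each Gaussian part at most `n^{2-p}`. A union
bound over coordinates gives (i), and (i) with polynomial dimension gives (ii).

Fuk–Nagaev under dependence (`exists_fukNagaev_past`) comes from telescoping conditional
expectations on the most recent `j` innovations. Level `j` depends on `j + 1` consecutive
innovations, so each residue class modulo `j + 1` is an independent sum; its `p`-norm is controlled
by the dependence coefficient. Levels beyond the block length are handled by Minkowski alone. -/

/-! ### Fuk–Nagaev inequality for independent summands. -/

/-- Quadratic Taylor bound while `l * t ≤ 1`. Beyond that `M - t ≤ l t (M - t)`, so `M / t ≤ 1 + l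
(M - t)`, and the `p`-th power of the right side is at most `p ^ p * exp (l (M - t))`. Negative `t`
needs no truncation. -/
lemma exp_mul_le_of_le {p M l t : ℝ} (hp : 1 ≤ p) (hM : 0 < M) (hl : 0 ≤ l) (ht : t ≤ M) :
    Real.exp (l * t) ≤
      1 + l * t + (l * t) ^ 2 + p ^ p * (|t| / M) ^ p * Real.exp (l * M) := by
  have hp0 : 0 < p := by linarith
  have hnn : 0 ≤ p ^ p * (|t| / M) ^ p * Real.exp (l * M) := by positivity
  rcases le_or_gt (l * t) 1 with h | h
  · rcases le_or_gt (-1) (l * t) with h1 | h1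
    · have h2 := Real.abs_exp_sub_one_sub_id_le (abs_le.2 ⟨h1, h⟩)
      have := (abs_le.1 h2).2
      linarith
    · have : Real.exp (l * t) ≤ 1 := Real.exp_le_one_iff.2 (by linarith)
      nlinarith
  · have hl0 : 0 < l := by
      rcases hl.eq_or_lt with h0 | h0
      · simp [← h0] at h; linarith
      · exact h0
    have ht0 : 0 < t := by
      by_contra hc
      nlinarith
    have hlt : l * t ≤ l * M := by gcongr
    have key : M / t ≤ p * Real.exp ((l * M - l * t) / p) := by
      have h1 : M / t ≤ 1 + (l * M - l * t) := by
        rw [div_le_iff₀ ht0]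
        nlinarith
      have h2 := Real.add_one_le_exp ((l * M - l * t) / p)
      have h3 : p * ((l * M - l * t) / p + 1) ≤ p * Real.exp ((l * M - l * t) / p) := by gcongr
      have h4 : p * ((l * M - l * t) / p + 1) = (l * M - l * t) + p := by field_simp
      linarith
    have h5 : (M / t) ^ p ≤ p ^ p * Real.exp (l * M - l * t) := by
      calc (M / t) ^ p ≤ (p * Real.exp ((l * M - l * t) / p)) ^ p := by gcongr
        _ = p ^ p * Real.exp (l * M - l * t) := by
          rw [Real.mul_rpow hp0.le (Real.exp_pos _).le, ← Real.exp_mul, div_mul_cancel₀ _ hp0.ne']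
    have h6 : (M / t) ^ p * (|t| / M) ^ p = 1 := by
      rw [abs_of_pos ht0, ← Real.mul_rpow (by positivity) (by positivity)]
      have : M / t * (t / M) = 1 := by field_simp
      rw [this, Real.one_rpow]
    have h7 : Real.exp (l * t) ≤ p ^ p * (|t| / M) ^ p * Real.exp (l * M) := by
      calc Real.exp (l * t) = ((M / t) ^ p * (|t| / M) ^ p) * Real.exp (l * t) := by rw [h6, one_mul]
        _ ≤ (p ^ p * Real.exp (l * M - l * t)) * (|t| / M) ^ p * Real.exp (l * t) := by gcongr
        _ = p ^ p * (|t| / M) ^ p * (Real.exp (l * M - l * t) * Real.exp (l * t)) := by ring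
        _ = _ := by rw [← Real.exp_add]; congr 2; ring
    nlinarith

section moments

variable {Ω : Type*} [MeasurableSpace Ω] {P : Measure Ω}

lemma integrable_abs_rpow_of_eLpNorm_le {p s : ℝ} (hp : 0 < p) {Y : Ω → ℝ}
    (hY : AEStronglyMeasurable Y P) (hs : eLpNorm Y (ENNReal.ofReal p) P ≤ ENNReal.ofReal s) :
    Integrable (fun ω => |Y ω| ^ p) P := by
  have h : MemLp Y (ENNReal.ofReal p) P := ⟨hY, hs.trans_lt ENNReal.ofReal_lt_top⟩
  have := h.integrable_norm_rpow (by simpa using hp) ENNReal.ofReal_ne_top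
  simpa [ENNReal.toReal_ofReal hp.le] using this

lemma integral_abs_rpow_le_of_eLpNorm_le {p s : ℝ} (hp : 0 < p) (hs0 : 0 ≤ s) {Y : Ω → ℝ}
    (hY : AEStronglyMeasurable Y P) (hs : eLpNorm Y (ENNReal.ofReal p) P ≤ ENNReal.ofReal s) :
    ∫ ω, |Y ω| ^ p ∂P ≤ s ^ p := by
  have h : MemLp Y (ENNReal.ofReal p) P := ⟨hY, hs.trans_lt ENNReal.ofReal_lt_top⟩
  rw [h.eLpNorm_eq_integral_rpow_norm (by simpa using hp) ENNReal.ofReal_ne_top,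
    ENNReal.ofReal_le_ofReal_iff hs0, ENNReal.toReal_ofReal hp.le] at hs
  have h0 : 0 ≤ ∫ ω, |Y ω| ^ p ∂P := integral_nonneg fun ω => by positivity
  simp only [Real.norm_eq_abs] at hs
  calc ∫ ω, |Y ω| ^ p ∂P = ((∫ ω, |Y ω| ^ p ∂P) ^ p⁻¹) ^ p := by
        rw [← Real.rpow_mul h0, inv_mul_cancel₀ hp.ne', Real.rpow_one]
    _ ≤ s ^ p := by gcongr

lemma measureReal_abs_ge_le_of_eLpNorm_le [IsFiniteMeasure P] {p s y : ℝ} (hp : 0 < p)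
    (hs0 : 0 ≤ s) (hy : 0 < y) {Y : Ω → ℝ}
    (hY : AEStronglyMeasurable Y P) (hs : eLpNorm Y (ENNReal.ofReal p) P ≤ ENNReal.ofReal s) :
    P.real {ω | y ≤ |Y ω|} ≤ s ^ p / y ^ p := by
  have h1 := mul_meas_ge_le_integral_of_nonneg (μ := P)
    (Eventually.of_forall fun ω => (by positivity : 0 ≤ |Y ω| ^ p))
    (integrable_abs_rpow_of_eLpNorm_le hp hY hs) (y ^ p)
  have h2 : {ω | y ^ p ≤ |Y ω| ^ p} = {ω | y ≤ |Y ω|} := by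
    ext ω
    simp [Real.rpow_le_rpow_iff hy.le (abs_nonneg _) hp]
  rw [h2] at h1
  rw [le_div_iff₀ (by positivity), mul_comm]
  exact h1.trans (integral_abs_rpow_le_of_eLpNorm_le hp hs0 hY hs)

/-- Values above `M` are replaced by `0`, where the exponential is `1 ≤ 1 + l Y`. The pointwise
bound is thus linear in the untruncated `Y`, whose mean is zero, and no recentring is needed. -/
lemma mgf_truncation_le [IsProbabilityMeasure P] {p s M l : ℝ} (hp : 2 ≤ p) (hs0 : 0 ≤ s)
    (hM : 0 < M) (hl : 0 ≤ l) {Y : Ω → ℝ} (hYm : Measurable Y)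
    (hY0 : ∫ ω, Y ω ∂P = 0) (hs : eLpNorm Y (ENNReal.ofReal p) P ≤ ENNReal.ofReal s) :
    mgf (fun ω => if Y ω ≤ M then Y ω else 0) P l ≤
      Real.exp (l ^ 2 * s ^ 2 + p ^ p * (s / M) ^ p * Real.exp (l * M)) := by
  have hY := hYm.aestronglyMeasurable (μ := P)
  have hLp : MemLp Y (ENNReal.ofReal p) P := ⟨hY, hs.trans_lt ENNReal.ofReal_lt_top⟩
  have h2p : (ENNReal.ofReal 2) ≤ ENNReal.ofReal p := ENNReal.ofReal_le_ofReal hp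
  have hs2 : eLpNorm Y (ENNReal.ofReal 2) P ≤ ENNReal.ofReal s :=
    (eLpNorm_le_eLpNorm_of_exponent_le h2p hY).trans hs
  have hi1 : Integrable Y P := hLp.integrable (by
    rw [← ENNReal.ofReal_one]; exact ENNReal.ofReal_le_ofReal (by linarith))
  have hi2 := integrable_abs_rpow_of_eLpNorm_le two_pos hY hs2
  have hb2 := integral_abs_rpow_le_of_eLpNorm_le two_pos hs0 hY hs2
  have hip := integrable_abs_rpow_of_eLpNorm_le (by linarith : 0 < p) hY hs
  have hbp := integral_abs_rpow_le_of_eLpNorm_le (by linarith : 0 < p) hs0 hY hs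
  simp only [Real.rpow_two, sq_abs] at hi2 hb2
  set K : ℝ := p ^ p * Real.exp (l * M) / M ^ p with hK
  have hpt : ∀ ω, Real.exp (l * (if Y ω ≤ M then Y ω else 0)) ≤
      1 + l * Y ω + l ^ 2 * Y ω ^ 2 + K * |Y ω| ^ p := by
    intro ω
    have hKn : 0 ≤ K * |Y ω| ^ p := by positivity
    split_ifs with h
    · have := exp_mul_le_of_le (by linarith : 1 ≤ p) hM hl h
      rw [Real.div_rpow (abs_nonneg _) hM.le, mul_pow] at this
      refine this.trans_eq ?_
      rw [hK]; ring
    · have : 0 ≤ Y ω := by linarith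
      simp only [mul_zero, Real.exp_zero]
      have : 0 ≤ l * Y ω := by positivity
      nlinarith [sq_nonneg (l * Y ω)]
  have hI1 : Integrable (fun ω => 1 + l * Y ω) P := (integrable_const 1).add (hi1.const_mul l)
  have hI2 : Integrable (fun ω => 1 + l * Y ω + l ^ 2 * Y ω ^ 2) P :=
    hI1.add (hi2.const_mul (l ^ 2))
  have hI : Integrable (fun ω => 1 + l * Y ω + l ^ 2 * Y ω ^ 2 + K * |Y ω| ^ p) P :=
    hI2.add (hip.const_mul K)
  calc mgf (fun ω => if Y ω ≤ M then Y ω else 0) P l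
      ≤ ∫ ω, (1 + l * Y ω + l ^ 2 * Y ω ^ 2 + K * |Y ω| ^ p) ∂P :=
        integral_mono_of_nonneg (Eventually.of_forall fun ω => (Real.exp_pos _).le) hI
          (Eventually.of_forall hpt)
    _ = 1 + l ^ 2 * ∫ ω, Y ω ^ 2 ∂P + K * ∫ ω, |Y ω| ^ p ∂P := by
        rw [integral_add hI2 (hip.const_mul K), integral_add hI1 (hi2.const_mul (l ^ 2)),
          integral_add (integrable_const 1) (hi1.const_mul l),
          integral_const_mul, integral_const_mul, integral_const_mul, hY0]
        simp
    _ ≤ 1 + l ^ 2 * s ^ 2 + K * s ^ p := by gcongr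
    _ = (l ^ 2 * s ^ 2 + p ^ p * (s / M) ^ p * Real.exp (l * M)) + 1 := by
        rw [Real.div_rpow hs0 hM.le, hK]; ring
    _ ≤ _ := Real.add_one_le_exp _

/-- The constant in the Fuk–Nagaev inequality. -/
noncomputable def fukNagaevConst (p : ℝ) : ℝ := 2 ^ p + Real.exp (p ^ p * 2 ^ p)

lemma one_le_fukNagaevConst {p : ℝ} (hp : 0 ≤ p) : 1 ≤ fukNagaevConst p := by
  have h1 : (1:ℝ) ≤ 2 ^ p := Real.one_le_rpow (by norm_num) hp
  have h2 := Real.exp_pos (p ^ p * 2 ^ p)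
  unfold fukNagaevConst; linarith

/-- One-sided Fuk–Nagaev inequality. -/
theorem measureReal_sum_ge_le_fukNagaev [IsProbabilityMeasure P] {ι : Type*} [Fintype ι]
    {p s N y : ℝ} (hp : 2 ≤ p) (hs0 : 0 < s) (hN : 0 < N) (hy : 0 < y)
    (hcard : (Fintype.card ι : ℝ) ≤ N) {Y : ι → Ω → ℝ} (hYm : ∀ i, Measurable (Y i))
    (hind : iIndepFun Y P) (hY0 : ∀ i, ∫ ω, Y i ω ∂P = 0)
    (hs : ∀ i, eLpNorm (Y i) (ENNReal.ofReal p) P ≤ ENNReal.ofReal s) :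
    P.real {ω | y ≤ ∑ i, Y i ω} ≤
      fukNagaevConst p * (N * s ^ p / y ^ p + Real.exp (-(y ^ 2 / (4 * N * s ^ 2)))) := by
  have hp0 : 0 < p := by linarith
  have hC := one_le_fukNagaevConst hp0.le
  have hexp := Real.exp_pos (-(y ^ 2 / (4 * N * s ^ 2)))
  set b : ℝ := N * s ^ p / y ^ p with hb
  have hb0 : 0 < b := by positivity
  rcases le_or_gt 1 b with h1 | h1
  -- For `b ≥ 1` the claim is trivial because the constant is at least `1`; otherwise `log b⁻¹ > 0`.
  · calc P.real {ω | y ≤ ∑ i, Y i ω} ≤ 1 := measureReal_le_one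
      _ ≤ _ := by nlinarith
  set M := y / 2 with hM
  have hM0 : 0 < M := by positivity
  -- The first entry is the Gaussian optimum and gives `N l² s² ≤ l y / 2`. The second caps `exp (l
  -- M)` at `b⁻¹`, so the truncation term stays below `p ^ p * 2 ^ p`. The remaining `exp (-l y /
  -- 2)` equals the Gaussian term or `b`, according to which entry is smaller.
  set l : ℝ := min (y / (2 * N * s ^ 2)) (2 * Real.log b⁻¹ / y) with hl
  have hlog : 0 < Real.log b⁻¹ := Real.log_pos ((one_lt_inv₀ hb0).2 h1)
  have hl0 : 0 ≤ l := le_min (by positivity) (by positivity)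
  set T : ι → Ω → ℝ := fun i ω => if Y i ω ≤ M then Y i ω else 0 with hT
  have hTm : ∀ i, Measurable (T i) := fun i =>
    Measurable.ite (measurableSet_le (hYm i) measurable_const) (hYm i) measurable_const
  have hTind : iIndepFun T P :=
    hind.comp (fun _ (x : ℝ) => if x ≤ M then x else 0) fun _ =>
      Measurable.ite (measurableSet_le measurable_id measurable_const) measurable_id
        measurable_const
  have hsub : {ω | y ≤ ∑ i, Y i ω} ⊆
      (⋃ i ∈ (Finset.univ : Finset ι), {ω | M ≤ |Y i ω|}) ∪ {ω | y ≤ (∑ i, T i) ω} := by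
    intro ω hω
    by_cases hc : ∃ i, M ≤ |Y i ω|
    · left
      obtain ⟨i, hi⟩ := hc
      simp only [Set.mem_iUnion]
      exact ⟨i, Finset.mem_univ i, hi⟩
    · right
      push Not at hc
      have : ∀ i, T i ω = Y i ω := fun i => by
        simp only [hT]; rw [if_pos]; exact (le_abs_self _).trans (hc i).le
      simpa [this] using hω
  have hA : P.real (⋃ i ∈ (Finset.univ : Finset ι), {ω | M ≤ |Y i ω|}) ≤ 2 ^ p * b := by
    calc P.real (⋃ i ∈ (Finset.univ : Finset ι), {ω | M ≤ |Y i ω|})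
        ≤ ∑ i, P.real {ω | M ≤ |Y i ω|} := measureReal_biUnion_finset_le _ _
      _ ≤ ∑ i : ι, s ^ p / M ^ p := Finset.sum_le_sum fun i _ =>
          measureReal_abs_ge_le_of_eLpNorm_le hp0 hs0.le hM0 (hYm i).aestronglyMeasurable (hs i)
      _ = Fintype.card ι * (s ^ p / M ^ p) := by simp
      _ ≤ N * (s ^ p / M ^ p) := by gcongr
      _ = 2 ^ p * b := by
          rw [hM, hb, Real.div_rpow hy.le (by norm_num)]; field_simp
  have hintT : Integrable (fun ω => Real.exp (l * (∑ i, T i) ω)) P := by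
    refine Integrable.of_bound (C := Real.exp (l * (Fintype.card ι * M))) ?_ ?_
    · have : Measurable fun ω => ∑ i, T i ω := Finset.measurable_sum _ fun i _ => hTm i
      simp only [Finset.sum_apply]
      fun_prop
    · refine Eventually.of_forall fun ω => ?_
      rw [Real.norm_eq_abs, abs_of_pos (Real.exp_pos _)]
      gcongr
      rw [Finset.sum_apply]
      calc ∑ i, T i ω ≤ ∑ i : ι, M := Finset.sum_le_sum fun i _ => by
            simp only [hT]; split_ifs with h
            · exact h
            · exact hM0.le
        _ = _ := by simp
  have hB : P.real {ω | y ≤ (∑ i, T i) ω} ≤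
      Real.exp (p ^ p * 2 ^ p) * (b + Real.exp (-(y ^ 2 / (4 * N * s ^ 2)))) := by
    refine (measure_ge_le_exp_mul_mgf y hl0 hintT).trans ?_
    rw [hTind.mgf_sum hTm]
    set q := l ^ 2 * s ^ 2 + p ^ p * (s / M) ^ p * Real.exp (l * M) with hq
    have hq0 : 0 ≤ q := by positivity
    have h2 : ∏ i, mgf (T i) P l ≤ Real.exp (N * q) := by
      calc ∏ i, mgf (T i) P l ≤ ∏ i : ι, Real.exp q :=
            Finset.prod_le_prod (fun i _ => mgf_nonneg) fun i _ =>
              mgf_truncation_le hp hs0.le hM0 hl0 (hYm i) (hY0 i) (hs i)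
        _ = Real.exp (Fintype.card ι * q) := by simp [Real.exp_nat_mul]
        _ ≤ _ := by gcongr
    have h3 : N * (p ^ p * (s / M) ^ p * Real.exp (l * M)) ≤ p ^ p * 2 ^ p := by
      have h4 : Real.exp (l * M) ≤ b⁻¹ := by
        rw [← Real.exp_log (inv_pos.2 hb0)]
        gcongr
        calc l * M ≤ (2 * Real.log b⁻¹ / y) * M := by gcongr; exact min_le_right _ _
          _ = Real.log b⁻¹ := by rw [hM]; field_simp
      calc N * (p ^ p * (s / M) ^ p * Real.exp (l * M))
          ≤ N * (p ^ p * (s / M) ^ p * b⁻¹) := by gcongr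
        _ = p ^ p * 2 ^ p := by
          rw [hM, hb, Real.div_rpow hs0.le (by positivity), Real.div_rpow hy.le (by norm_num)]
          field_simp
    have h5 : N * (l ^ 2 * s ^ 2) ≤ l * y / 2 := by
      have : l * (2 * N * s ^ 2) ≤ y := by
        rw [← le_div_iff₀ (by positivity)]; exact min_le_left _ _
      nlinarith
    have h6 : Real.exp (-(l * y / 2)) ≤ b + Real.exp (-(y ^ 2 / (4 * N * s ^ 2))) := by
      rcases min_choice (y / (2 * N * s ^ 2)) (2 * Real.log b⁻¹ / y) with h | h
      · have : l * y / 2 = y ^ 2 / (4 * N * s ^ 2) := by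
          rw [hl, h]; field_simp; ring
        rw [this]; linarith
      · have : -(l * y / 2) = Real.log b := by
          rw [hl, h, Real.log_inv]; field_simp
        rw [this, Real.exp_log hb0]; linarith
    calc Real.exp (-l * y) * ∏ i, mgf (T i) P l
        ≤ Real.exp (-l * y) * Real.exp (N * q) := by gcongr
      _ = Real.exp (-l * y + N * q) := by rw [Real.exp_add]
      _ ≤ Real.exp (p ^ p * 2 ^ p + -(l * y / 2)) := by
          refine Real.exp_le_exp.2 ?_
          rw [hq]; linarith
      _ = Real.exp (p ^ p * 2 ^ p) * Real.exp (-(l * y / 2)) := Real.exp_add _ _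
      _ ≤ _ := by gcongr
  calc P.real {ω | y ≤ ∑ i, Y i ω} ≤ _ := measureReal_mono hsub
    _ ≤ _ := measureReal_union_le _ _
    _ ≤ 2 ^ p * b + Real.exp (p ^ p * 2 ^ p) * (b + Real.exp (-(y ^ 2 / (4 * N * s ^ 2)))) :=
        add_le_add hA hB
    _ ≤ _ := by
        have : (0:ℝ) < 2 ^ p := by positivity
        unfold fukNagaevConst
        nlinarith

/-- Two-sided Fuk–Nagaev inequality. -/
theorem measureReal_abs_sum_ge_le_fukNagaev [IsProbabilityMeasure P] {ι : Type*} [Fintype ι]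
    {p s N y : ℝ} (hp : 2 ≤ p) (hs0 : 0 < s) (hN : 0 < N) (hy : 0 < y)
    (hcard : (Fintype.card ι : ℝ) ≤ N) {Y : ι → Ω → ℝ} (hYm : ∀ i, Measurable (Y i))
    (hind : iIndepFun Y P) (hY0 : ∀ i, ∫ ω, Y i ω ∂P = 0)
    (hs : ∀ i, eLpNorm (Y i) (ENNReal.ofReal p) P ≤ ENNReal.ofReal s) :
    P.real {ω | y ≤ |∑ i, Y i ω|} ≤
      2 * fukNagaevConst p * (N * s ^ p / y ^ p + Real.exp (-(y ^ 2 / (4 * N * s ^ 2)))) := by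
  have h1 := measureReal_sum_ge_le_fukNagaev hp hs0 hN hy hcard hYm hind hY0 hs
  have h2 := measureReal_sum_ge_le_fukNagaev (P := P) hp hs0 hN hy hcard
    (Y := fun i ω => -Y i ω) (fun i => (hYm i).neg)
    (hind.comp (fun _ (x : ℝ) => -x) fun _ => measurable_neg)
    (fun i => by rw [integral_neg, hY0, neg_zero])
    (fun i => by
      have := hs i
      rwa [← eLpNorm_neg] at this)
  have hsub : {ω | y ≤ |∑ i, Y i ω|} ⊆
      {ω | y ≤ ∑ i, Y i ω} ∪ {ω | y ≤ ∑ i, -Y i ω} := by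
    intro ω hω
    rcases le_abs.1 (show y ≤ |∑ i, Y i ω| from hω) with h | h
    · exact Or.inl h
    · right; simpa using h
  calc _ ≤ _ := measureReal_mono hsub
    _ ≤ _ := measureReal_union_le _ _
    _ ≤ _ := add_le_add h1 h2
    _ = _ := by ring

end moments

/-! ### Martingale decomposition by resampling of innovations. -/

section coupling

set_option linter.unusedSectionVars false

variable {𝕊 : Type*}

/-- The sequence with entries `x i` for `i < j` and `z i` for `i ≥ j`. -/
def splice (j : ℕ) (x z : ℕ → 𝕊) : ℕ → 𝕊 := fun i => if i < j then x i else z i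

lemma splice_zero (x z : ℕ → 𝕊) : splice 0 x z = z := by
  ext i; simp [splice]

lemma splice_congr {j : ℕ} {x x' : ℕ → 𝕊} (h : ∀ i < j, x i = x' i) (z : ℕ → 𝕊) :
    splice j x z = splice j x' z := by
  ext i
  unfold splice
  split_ifs with hi
  · exact h i hi
  · rfl

/-- Lets two consecutive conditional means be compared on one tail `z`: averaging over coordinate
`j` is the same as resampling it. -/
lemma splice_update (j : ℕ) (x z : ℕ → 𝕊) (s : 𝕊) :
    splice j x (Function.update z j s) = Function.update (splice (j + 1) x z) j s := by
  ext i
  simp only [splice, Function.update_apply]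
  split_ifs <;> first | rfl | omega

variable [MeasurableSpace 𝕊]

@[fun_prop]
lemma measurable_splice (j : ℕ) :
    Measurable (fun q : (ℕ → 𝕊) × (ℕ → 𝕊) => splice j q.1 q.2) := by
  refine measurable_pi_lambda _ fun i => ?_
  unfold splice
  split_ifs <;> fun_prop

lemma measurable_update_prod (j : ℕ) :
    Measurable (fun q : (ℕ → 𝕊) × 𝕊 => Function.update q.1 j q.2) := by
  refine measurable_pi_lambda _ fun i => ?_
  simp only [Function.update_apply]
  split_ifs <;> fun_prop

variable (ν : Measure 𝕊) [IsProbabilityMeasure ν]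

/-- The law of an i.i.d. sequence with marginal `ν`. -/
noncomputable abbrev iidLaw : Measure (ℕ → 𝕊) := Measure.infinitePi fun _ : ℕ => ν

lemma measurePreserving_splice (j : ℕ) :
    MeasurePreserving (fun q : (ℕ → 𝕊) × (ℕ → 𝕊) => splice j q.1 q.2)
      ((iidLaw ν).prod (iidLaw ν)) (iidLaw ν) := by
  refine ⟨measurable_splice j, Measure.eq_infinitePi _ fun S t ht => ?_⟩
  rw [Measure.map_apply (measurable_splice j)
    (MeasurableSet.pi S.countable_toSet fun i _ => ht i)]
  have : (fun q : (ℕ → 𝕊) × (ℕ → 𝕊) => splice j q.1 q.2) ⁻¹' (Set.pi S t) =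
      (Set.pi (S.filter (· < j) : Finset ℕ) t) ×ˢ
        (Set.pi (S.filter (fun i => ¬ i < j) : Finset ℕ) t) := by
    ext q
    simp only [Set.mem_preimage, Set.mem_pi, Set.mem_prod, Finset.coe_filter,
      Set.mem_ofPred_eq, splice, Finset.mem_coe]
    constructor
    · intro h
      refine ⟨fun i hi => ?_, fun i hi => ?_⟩
      · simpa [hi.2] using h i hi.1
      · simpa [hi.2] using h i hi.1
    · rintro ⟨h1, h2⟩ i hi
      split_ifs with hij
      · exact h1 i ⟨hi, hij⟩
      · exact h2 i ⟨hi, hij⟩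
  rw [this, Measure.prod_prod, Measure.infinitePi_pi _ fun i _ => ht i,
    Measure.infinitePi_pi _ fun i _ => ht i]
  exact Finset.prod_filter_mul_prod_filter_not S _ _

lemma measurePreserving_update (j : ℕ) :
    MeasurePreserving (fun q : (ℕ → 𝕊) × 𝕊 => Function.update q.1 j q.2)
      ((iidLaw ν).prod ν) (iidLaw ν) := by
  refine ⟨measurable_update_prod j, Measure.eq_infinitePi _ fun S t ht => ?_⟩
  rw [Measure.map_apply (measurable_update_prod j)
    (MeasurableSet.pi S.countable_toSet fun i _ => ht i)]
  have : (fun q : (ℕ → 𝕊) × 𝕊 => Function.update q.1 j q.2) ⁻¹' (Set.pi S t) =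
      (Set.pi (S.erase j : Finset ℕ) t) ×ˢ (if j ∈ S then t j else Set.univ) := by
    ext q
    simp only [Set.mem_preimage, Set.mem_pi, Set.mem_prod, Finset.mem_coe, Finset.mem_erase,
      Function.update_apply]
    constructor
    · intro h
      refine ⟨fun i hi => ?_, ?_⟩
      · simpa [hi.1] using h i hi.2
      · split_ifs with hj
        · simpa using h j hj
        · trivial
    · rintro ⟨h1, h2⟩ i hi
      split_ifs with hij
      · subst hij; simpa [hi] using h2
      · exact h1 i ⟨hij, hi⟩
  rw [this, Measure.prod_prod, Measure.infinitePi_pi _ fun i _ => ht i]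
  split_ifs with hj
  · exact Finset.prod_erase_mul S _ hj
  · rw [Finset.erase_eq_of_notMem hj]; simp

lemma measurePreserving_splice_prod (j : ℕ) :
    MeasurePreserving (fun q : (ℕ → 𝕊) × ((ℕ → 𝕊) × 𝕊) => (splice j q.1 q.2.1, q.2.2))
      ((iidLaw ν).prod ((iidLaw ν).prod ν)) ((iidLaw ν).prod ν) :=
  ((measurePreserving_splice ν j).prod (MeasurePreserving.id ν)).comp
    ((measurePreserving_prodAssoc (iidLaw ν) (iidLaw ν) ν).symm _)

/-- Jensen's inequality for the partial integral of a function on a product space. -/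
lemma eLpNorm_integral_prod_le {α β : Type*} [MeasurableSpace α] [MeasurableSpace β]
    {μ : Measure α} {Q : Measure β} [IsProbabilityMeasure Q] {p : ℝ} (hp : 1 ≤ p)
    {F : α × β → ℝ} (hF : Measurable F) :
    eLpNorm (fun x => ∫ w, F (x, w) ∂Q) (ENNReal.ofReal p) μ ≤
      eLpNorm F (ENNReal.ofReal p) (μ.prod Q) := by
  have hp0 : 0 < p := by linarith
  have h0 : ENNReal.ofReal p ≠ 0 := by simpa using hp0
  rw [eLpNorm_eq_lintegral_rpow_enorm_toReal h0 ENNReal.ofReal_ne_top,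
    eLpNorm_eq_lintegral_rpow_enorm_toReal h0 ENNReal.ofReal_ne_top,
    ENNReal.toReal_ofReal hp0.le]
  gcongr
  rw [lintegral_prod _ (by fun_prop)]
  refine lintegral_mono fun x => ?_
  have h1 : eLpNorm (fun w => F (x, w)) 1 Q ≤ eLpNorm (fun w => F (x, w)) (ENNReal.ofReal p) Q :=
    eLpNorm_le_eLpNorm_of_exponent_le (by simpa using hp)
      (hF.comp measurable_prodMk_left).aestronglyMeasurable
  rw [eLpNorm_one_eq_lintegral_enorm, eLpNorm_eq_lintegral_rpow_enorm_toReal h0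
    ENNReal.ofReal_ne_top, ENNReal.toReal_ofReal hp0.le] at h1
  calc ‖∫ w, F (x, w) ∂Q‖ₑ ^ p ≤ (∫⁻ w, ‖F (x, w)‖ₑ ∂Q) ^ p := by
        gcongr; exact enorm_integral_le_lintegral_enorm _
    _ ≤ ((∫⁻ w, ‖F (x, w)‖ₑ ^ p ∂Q) ^ (1 / p)) ^ p := by gcongr
    _ = ∫⁻ w, ‖F (x, w)‖ₑ ^ p ∂Q := by
        rw [← ENNReal.rpow_mul, one_div_mul_cancel hp0.ne', ENNReal.rpow_one]

/-- The conditional expectation of `g` given the coordinates `i < j`. -/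
noncomputable def headMean (g : (ℕ → 𝕊) → ℝ) (j : ℕ) (x : ℕ → 𝕊) : ℝ :=
  ∫ z, g (splice j x z) ∂(iidLaw ν)

/-- The increment of the conditional expectation when coordinate `j` is added. -/
noncomputable def headDiff (g : (ℕ → 𝕊) → ℝ) (j : ℕ) (x : ℕ → 𝕊) : ℝ :=
  headMean ν g (j + 1) x - headMean ν g j x

variable {ν} {g : (ℕ → 𝕊) → ℝ}

lemma measurable_headMean (hg : Measurable g) (j : ℕ) : Measurable (headMean ν g j) := by
  have : StronglyMeasurable (fun q : (ℕ → 𝕊) × (ℕ → 𝕊) => g (splice j q.1 q.2)) :=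
    (hg.comp (measurable_splice j)).stronglyMeasurable
  exact this.integral_prod_right.measurable

lemma measurable_headDiff (hg : Measurable g) (j : ℕ) : Measurable (headDiff ν g j) :=
  (measurable_headMean hg _).sub (measurable_headMean hg _)

lemma headMean_congr {j : ℕ} {x x' : ℕ → 𝕊} (h : ∀ i < j, x i = x' i) :
    headMean ν g j x = headMean ν g j x' := by
  simp only [headMean, splice_congr h]

lemma headDiff_congr {j : ℕ} {x x' : ℕ → 𝕊} (h : ∀ i < j + 1, x i = x' i) :
    headDiff ν g j x = headDiff ν g j x' := by
  rw [headDiff, headDiff, headMean_congr h, headMean_congr fun i hi => h i (by omega)]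

lemma integrable_splice (hi : Integrable g (iidLaw ν)) (j : ℕ) :
    Integrable (fun q : (ℕ → 𝕊) × (ℕ → 𝕊) => g (splice j q.1 q.2))
      ((iidLaw ν).prod (iidLaw ν)) :=
  (measurePreserving_splice ν j).integrable_comp_of_integrable hi

lemma integrable_headMean (hi : Integrable g (iidLaw ν)) (j : ℕ) :
    Integrable (headMean ν g j) (iidLaw ν) :=
  (integrable_splice hi j).integral_prod_left

lemma integral_headMean (hg : Measurable g) (hi : Integrable g (iidLaw ν)) (j : ℕ) :
    ∫ x, headMean ν g j x ∂(iidLaw ν) = ∫ x, g x ∂(iidLaw ν) := by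
  unfold headMean
  rw [← integral_prod _ (integrable_splice hi j), ← (measurePreserving_splice ν j).map_eq,
    integral_map (measurable_splice j).aemeasurable hg.aestronglyMeasurable,
    (measurePreserving_splice ν j).map_eq]

lemma integral_headDiff (hg : Measurable g) (hi : Integrable g (iidLaw ν)) (j : ℕ) :
    ∫ x, headDiff ν g j x ∂(iidLaw ν) = 0 := by
  unfold headDiff
  rw [integral_sub (integrable_headMean hi _) (integrable_headMean hi _),
    integral_headMean hg hi, integral_headMean hg hi, sub_self]

lemma headMean_zero (x : ℕ → 𝕊) : headMean ν g 0 x = ∫ z, g z ∂(iidLaw ν) := by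
  simp only [headMean, splice_zero]

lemma sum_headDiff (h0 : ∫ z, g z ∂(iidLaw ν) = 0) (J : ℕ) (x : ℕ → 𝕊) :
    ∑ j ∈ Finset.range J, headDiff ν g j x = headMean ν g J x := by
  simp only [headDiff]
  rw [Finset.sum_range_sub (fun j => headMean ν g j x), headMean_zero, h0, sub_zero]

/-- Resampling coordinate `j` of an i.i.d. tail preserves its law, so both conditional means are
integrals over the same space. Jensen then bounds the increment by the dependence coefficient.
Almost everywhere only, since Fubini gives integrable sections for almost every `x`. -/
lemma headDiff_ae_eq (hg : Measurable g) (hi : Integrable g (iidLaw ν)) (j : ℕ) :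
    headDiff ν g j =ᵐ[iidLaw ν] fun x => ∫ w : (ℕ → 𝕊) × 𝕊,
      (g (splice (j + 1) x w.1) - g (Function.update (splice (j + 1) x w.1) j w.2))
        ∂((iidLaw ν).prod ν) := by
  filter_upwards [(integrable_splice hi (j + 1)).prod_right_ae,
    (integrable_splice hi j).prod_right_ae] with x h1 h2
  have hup := measurePreserving_update ν j
  have h3 : Integrable (fun w : (ℕ → 𝕊) × 𝕊 => g (splice (j + 1) x w.1)) ((iidLaw ν).prod ν) :=
    h1.comp_fst ν
  have hsp : Measurable (splice j x) := (measurable_splice j).comp measurable_prodMk_left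
  have h4 : Integrable (fun w : (ℕ → 𝕊) × 𝕊 => g (splice j x (Function.update w.1 j w.2)))
      ((iidLaw ν).prod ν) :=
    hup.integrable_comp_of_integrable (g := fun z => g (splice j x z)) h2
  simp only [splice_update] at h4
  rw [integral_sub h3 h4, headDiff, headMean, headMean]
  congr 1
  · rw [integral_fun_fst (fun z => g (splice (j + 1) x z))]; simp
  · simp only [← splice_update]
    rw [← integral_map (φ := fun w : (ℕ → 𝕊) × 𝕊 => Function.update w.1 j w.2)
      (f := fun z => g (splice j x z)) hup.measurable.aemeasurable
      (hg.comp hsp).aestronglyMeasurable, hup.map_eq]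

lemma eLpNorm_headDiff_le {p : ℝ} (hp : 1 ≤ p) (hg : Measurable g)
    (hi : Integrable g (iidLaw ν)) (j : ℕ) :
    eLpNorm (headDiff ν g j) (ENNReal.ofReal p) (iidLaw ν) ≤
      eLpNorm (fun w : (ℕ → 𝕊) × 𝕊 => g w.1 - g (Function.update w.1 j w.2))
        (ENNReal.ofReal p) ((iidLaw ν).prod ν) := by
  have hH : Measurable (fun w : (ℕ → 𝕊) × 𝕊 => g w.1 - g (Function.update w.1 j w.2)) :=
    (hg.comp measurable_fst).sub (hg.comp (measurable_update_prod j))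
  have hsp := measurePreserving_splice_prod ν (j + 1)
  rw [eLpNorm_congr_ae (headDiff_ae_eq hg hi j)]
  exact (eLpNorm_integral_prod_le hp (hH.comp hsp.measurable)).trans_eq
    (eLpNorm_comp_measurePreserving hH.aestronglyMeasurable hsp)

lemma iSup_piLE_eq_pi :
    ⨆ n : ℕ, (Filtration.piLE (X := fun _ : ℕ => 𝕊)) n = MeasurableSpace.pi := by
  refine le_antisymm (iSup_le fun n => Filtration.le _ n) ?_
  refine iSup_le fun i => ?_
  refine le_trans ?_ (le_iSup _ i)
  rintro _ ⟨t, ht, rfl⟩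
  have hm : Measurable fun y : (∀ _ : Set.Iic i, 𝕊) => y ⟨i, Set.mem_Iic.2 le_rfl⟩ :=
    measurable_pi_apply _
  exact ⟨(fun y => y ⟨i, Set.mem_Iic.2 le_rfl⟩) ⁻¹' t, hm ht, rfl⟩

/-- Opens the way to Lévy's upward theorem. The shift arises because the filtration at `n` contains
the coordinates `0, …, n`, which are `n + 1` in number. -/
lemma headMean_ae_eq_condExp (hg : Measurable g) (hi : Integrable g (iidLaw ν)) (n : ℕ) :
    headMean ν g (n + 1) =ᵐ[iidLaw ν] (iidLaw ν)[g | Filtration.piLE (X := fun _ : ℕ => 𝕊) n] := by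
  have hsp := measurePreserving_splice ν (n + 1)
  refine ae_eq_condExp_of_forall_setIntegral_eq (Filtration.le _ n) hi
    (fun s _ _ => (integrable_headMean hi _).integrableOn) (fun s hs _ => ?_) ?_
  · have hsm : MeasurableSet s := Filtration.le _ n s hs
    obtain ⟨t, ht, rfl⟩ := hs
    set s := Preorder.restrictLe (π := fun _ : ℕ => 𝕊) n ⁻¹' t with hsdef
    have hiff : ∀ x z : ℕ → 𝕊, splice (n + 1) x z ∈ s ↔ x ∈ s := fun x z => by
      have : Preorder.restrictLe (π := fun _ => 𝕊) n (splice (n + 1) x z) =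
          Preorder.restrictLe (π := fun _ => 𝕊) n x := by
        ext i
        have : (i : ℕ) < n + 1 := Nat.lt_succ_of_le i.2
        simp [splice, this]
      simp only [hsdef, Set.mem_preimage, this]
    have hi2 : Integrable (s.indicator g) (iidLaw ν) := hi.indicator hsm
    rw [← integral_indicator hsm, ← integral_indicator hsm,
      ← integral_headMean (hg.indicator hsm) hi2 (n + 1)]
    congr 1
    ext x
    by_cases hx : x ∈ s
    · simp only [Set.indicator_of_mem hx, headMean, Set.indicator_of_mem ((hiff x _).2 hx)]
    · simp only [Set.indicator_of_notMem hx, headMean,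
        Set.indicator_of_notMem (mt (hiff x _).1 hx), integral_zero]
  -- A filler point extends finite vectors to sequences, exhibiting the function as measurable in
  -- the restriction.
  · obtain ⟨s₀⟩ : Nonempty 𝕊 := ν.nonempty_of_neZero
    have hfac : headMean ν g (n + 1) =
        (fun y : (∀ _ : Set.Iic n, 𝕊) => headMean ν g (n + 1)
          (fun i => if h : i ≤ n then y ⟨i, h⟩ else s₀)) ∘ Preorder.restrictLe n := by
      ext x
      refine headMean_congr fun i hi => ?_
      have : i ≤ n := by omega
      simp [this]
    have hm1 : Measurable (fun y : (∀ _ : Set.Iic n, 𝕊) => headMean ν g (n + 1)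
          (fun i => if h : i ≤ n then y ⟨i, h⟩ else s₀)) := by
      refine (measurable_headMean hg _).comp (measurable_pi_lambda _ fun i => ?_)
      split_ifs <;> fun_prop
    rw [hfac]
    exact (hm1.comp (comap_measurable _)).aestronglyMeasurable

lemma tendsto_headMean_ae (hg : Measurable g) (hi : Integrable g (iidLaw ν)) :
    ∀ᵐ x ∂(iidLaw ν), Tendsto (fun n => headMean ν g n x) atTop (𝓝 (g x)) := by
  have h1 := hi.tendsto_ae_condExp (ℱ := Filtration.piLE (X := fun _ : ℕ => 𝕊)) (by
    rw [iSup_piLE_eq_pi]; exact hg.stronglyMeasurable)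
  have h2 := ae_all_iff.2 fun n => headMean_ae_eq_condExp hg hi n
  filter_upwards [h1, h2] with x hx1 hx2
  rw [← tendsto_add_atTop_iff_nat 1]
  exact hx1.congr fun n => (hx2 n).symm

/-- The tail of the martingale decomposition is controlled by the tail of the dependence
coefficients. -/
lemma eLpNorm_sub_headMean_le {p : ℝ} (hp : 1 ≤ p) (hg : Measurable g)
    (hi : Integrable g (iidLaw ν)) {a : ℕ → ℝ≥0∞}
    (ha : ∀ j, eLpNorm (fun w : (ℕ → 𝕊) × 𝕊 => g w.1 - g (Function.update w.1 j w.2))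
        (ENNReal.ofReal p) ((iidLaw ν).prod ν) ≤ a j) (J : ℕ) :
    eLpNorm (fun x => g x - headMean ν g J x) (ENNReal.ofReal p) (iidLaw ν) ≤
      ∑' i, a (J + i) := by
  have hm : ∀ n, AEStronglyMeasurable
      (fun x => headMean ν g (J + n) x - headMean ν g J x) (iidLaw ν) := fun n =>
    ((measurable_headMean hg _).sub (measurable_headMean hg _)).aestronglyMeasurable
  -- Fatou in `L^p` along the almost sure limit `headMean ν g n → g`, then Minkowski on the
  -- telescoped increments.
  refine (Lp.eLpNorm_lim_le_liminf_eLpNorm hm _ ?_).trans ?_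
  · filter_upwards [tendsto_headMean_ae hg hi] with x hx
    refine Tendsto.sub_const ?_ _
    exact hx.comp (tendsto_atTop_mono (fun n => Nat.le_add_left n J) tendsto_id)
  · refine liminf_le_of_le (by isBoundedDefault) fun b hb => ?_
    obtain ⟨n, hn⟩ := hb.exists
    refine hn.trans ?_
    have heq : (fun x => headMean ν g (J + n) x - headMean ν g J x) =
        ∑ i ∈ Finset.range n, headDiff ν g (J + i) := by
      ext x
      rw [Finset.sum_apply]
      simp only [headDiff]
      exact (Finset.sum_range_sub (fun i => headMean ν g (J + i) x) n).symm
    rw [heq]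
    calc eLpNorm (∑ i ∈ Finset.range n, headDiff ν g (J + i)) (ENNReal.ofReal p) (iidLaw ν)
        ≤ ∑ i ∈ Finset.range n, eLpNorm (headDiff ν g (J + i)) (ENNReal.ofReal p) (iidLaw ν) :=
          eLpNorm_sum_le (fun i _ => (measurable_headDiff hg _).aestronglyMeasurable)
            (by simpa using hp)
      _ ≤ ∑ i ∈ Finset.range n, a (J + i) :=
          Finset.sum_le_sum fun i _ => (eLpNorm_headDiff_le hp hg hi _).trans (ha _)
      _ ≤ ∑' i, a (J + i) := ENNReal.sum_le_tsum _

end coupling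

/-! ### Independent blocks from residue classes. -/

/-- Rows of an independent array are independent. -/
lemma iIndepFun_curry {Ω ι κ 𝕊 : Type*} [MeasurableSpace Ω] [MeasurableSpace 𝕊] {P : Measure Ω}
    [IsProbabilityMeasure P] {X : ι × κ → Ω → 𝕊} (hX : ∀ q, Measurable (X q))
    (h : iIndepFun X P) : iIndepFun (fun i ω (k : κ) => X (i, k) ω) P := by
  have hpr : ∀ q, IsProbabilityMeasure (P.map (X q)) :=
    fun q => Measure.isProbabilityMeasure_map (hX q).aemeasurable
  rw [iIndepFun_iff_map_fun_eq_infinitePi_map (fun i => by fun_prop)]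
  have h1 : ∀ i, P.map (fun ω (k : κ) => X (i, k) ω) =
      Measure.infinitePi fun k => P.map (X (i, k)) := fun i =>
    (h.precomp (g := fun k => (i, k)) (fun a b hab => by simpa using hab)).map_fun_eq_infinitePi_map
      (fun k => hX _)
  simp only [h1]
  rw [← Measure.infinitePi_map_curry (fun i k => P.map (X (i, k)))]
  have h2 := h.map_fun_eq_infinitePi_map hX
  rw [← h2, Measure.map_map (by fun_prop) (by fun_prop)]
  rfl

/-- A class has at most `m / q + 1` members; `q ≤ m` absorbs the `1` into a factor `2`. -/
lemma card_filter_mod_le {l m q : ℕ} (hq : 0 < q) (hqm : q ≤ m) (hl : l ≤ m) (r : ℕ) :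
    (((Finset.range l).filter (fun k => k % q = r)).card : ℝ) ≤ 2 * m / q := by
  have h1 : ((Finset.range l).filter (fun k => k % q = r)).card ≤ m / q + 1 := by
    rw [← Finset.card_range (m / q + 1)]
    refine Finset.card_le_card_of_injOn (fun k => k / q) (fun k hk => ?_) ?_
    · simp only [Finset.coe_filter, Finset.mem_range, Set.mem_ofPred_eq] at hk
      simp only [Finset.coe_range, Set.mem_Iio]
      exact Nat.lt_succ_of_le (Nat.div_le_div_right (by omega))
    · intro k hk k' hk' h
      simp only [Finset.coe_filter, Finset.mem_range, Set.mem_ofPred_eq] at hk hk' h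
      rw [← Nat.div_add_mod k q, ← Nat.div_add_mod k' q, h, hk.2, hk'.2]
  have h2 : m / q + 1 ≤ 2 * (m / q) := by
    have : 1 ≤ m / q := (Nat.one_le_div_iff hq).2 hqm
    omega
  calc (((Finset.range l).filter (fun k => k % q = r)).card : ℝ)
      ≤ ((2 * (m / q) : ℕ) : ℝ) := by exact_mod_cast h1.trans h2
    _ = 2 * ((m / q : ℕ) : ℝ) := by push_cast; ring
    _ ≤ 2 * ((m : ℝ) / q) := by gcongr; exact Nat.cast_div_le
    _ = _ := by ring

section iid

set_option linter.unusedSectionVars false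

variable {Ω 𝕊 : Type*} [MeasurableSpace Ω] [MeasurableSpace 𝕊] {P : Measure Ω}
  [IsProbabilityMeasure P] {ν : Measure 𝕊} [IsProbabilityMeasure ν] {e : ℤ → Ω → 𝕊}

lemma measurable_past (he : ∀ k, Measurable (e k)) (k : ℤ) :
    Measurable fun ω => past (fun i => e i ω) k :=
  measurable_pi_lambda _ fun _ => he _

lemma measurePreserving_past (he : ∀ k, Measurable (e k)) (hind : iIndepFun e P)
    (hlaw : ∀ k, P.map (e k) = ν) (k : ℤ) :
    MeasurePreserving (fun ω => past (fun i => e i ω) k) P (iidLaw ν) := by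
  refine ⟨measurable_past he k, ?_⟩
  have h := (hind.precomp (g := fun j : ℕ => k - j)
    (fun a b hab => by simpa using hab)).map_fun_eq_infinitePi_map (fun j => he _)
  simp only [hlaw] at h
  exact h

/-- Two times in the same class differ by a multiple of `q`, so their windows of length `q` are
disjoint. This is the injectivity of `(k, i) ↦ b + k - i`. -/
lemma iIndepFun_past_of_modEq (he : ∀ k, Measurable (e k)) (hind : iIndepFun e P) {q : ℕ}
    {f : (ℕ → 𝕊) → ℝ} (hf : Measurable f)
    (hdep : ∀ x x' : ℕ → 𝕊, (∀ i < q, x i = x' i) → f x = f x')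
    (b : ℤ) (s : Finset ℕ) (r : ℕ) (hs : ∀ k ∈ s, k % q = r) :
    iIndepFun (fun (k : s) ω => f (past (fun i => e i ω) (b + (k : ℕ)))) P := by
  obtain ⟨ω₀⟩ : Nonempty Ω := P.nonempty_of_neZero
  set s₀ : 𝕊 := e 0 ω₀
  have hinj : Function.Injective fun w : s × Fin q => b + ((w.1 : ℕ) : ℤ) - ((w.2 : ℕ) : ℤ) := by
    rintro ⟨⟨k, hk⟩, i⟩ ⟨⟨k', hk'⟩, i'⟩ h
    simp only at h
    have h1 := hs k hk
    have h2 := hs k' hk'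
    have hi := i.2
    have hi' := i'.2
    have h3 : k + (i' : ℕ) = k' + (i : ℕ) := by omega
    have h4 : (i' : ℕ) ≡ i [MOD q] := by
      have : k ≡ k' [MOD q] := h1.trans h2.symm
      exact Nat.ModEq.add_left_cancel this (by rw [h3])
    have h5 : (i' : ℕ) = i := Nat.ModEq.eq_of_lt_of_lt h4 hi' hi
    have h6 : k = k' := by omega
    simp only [Prod.mk.injEq, Subtype.mk.injEq]
    exact ⟨h6, Fin.ext h5.symm⟩
  have h1 := iIndepFun_curry (fun _ => he _) (hind.precomp hinj)
  have hext : Measurable fun y : Fin q → 𝕊 =>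
      f (fun i => if h : i < q then y ⟨i, h⟩ else s₀) := by
    refine hf.comp (measurable_pi_lambda _ fun i => ?_)
    split_ifs <;> fun_prop
  have h2 := h1.comp (fun _ y => f (fun i => if h : i < q then y ⟨i, h⟩ else s₀)) fun _ => hext
  convert! h2 using 3 with k
  refine hdep _ _ fun i hi => ?_
  simp [past, hi]

/-- Fuk–Nagaev inequality for a function of finitely many consecutive innovations. -/
lemma measureReal_abs_sum_past_ge_le (he : ∀ k, Measurable (e k)) (hind : iIndepFun e P)
    (hlaw : ∀ k, P.map (e k) = ν) {p s u : ℝ} (hp : 2 ≤ p) (hs0 : 0 < s) (hu : 0 < u)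
    {l m q : ℕ} (hq : 0 < q) (hqm : q ≤ m) (hl : l ≤ m) {f : (ℕ → 𝕊) → ℝ} (hf : Measurable f)
    (hdep : ∀ x x' : ℕ → 𝕊, (∀ i < q, x i = x' i) → f x = f x')
    (hf0 : ∫ x, f x ∂(iidLaw ν) = 0)
    (hs : eLpNorm f (ENNReal.ofReal p) (iidLaw ν) ≤ ENNReal.ofReal s) (b : ℤ) :
    P.real {ω | u ≤ |∑ k ∈ Finset.range l, f (past (fun i => e i ω) (b + (k : ℕ)))|} ≤
      q * (2 * fukNagaevConst p * ((2 * m / q) * s ^ p / (u / q) ^ p +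
        Real.exp (-((u / q) ^ 2 / (4 * (2 * m / q) * s ^ 2))))) := by
  have hq0 : (0 : ℝ) < q := by exact_mod_cast hq
  have hm0 : (0 : ℝ) < m := by exact_mod_cast hq.trans_le hqm
  set B := 2 * fukNagaevConst p * ((2 * m / q) * s ^ p / (u / q) ^ p +
        Real.exp (-((u / q) ^ 2 / (4 * (2 * m / q) * s ^ 2)))) with hB
  set c : ℕ → Finset ℕ := fun r => (Finset.range l).filter (fun k => k % q = r) with hc
  set F : ℕ → Ω → ℝ := fun k ω => f (past (fun i => e i ω) (b + (k : ℕ))) with hF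
  have hsum : ∀ ω, ∑ k ∈ Finset.range l, F k ω = ∑ r ∈ Finset.range q, ∑ k ∈ c r, F k ω :=
    fun ω => (Finset.sum_fiberwise_of_maps_to
      (fun k _ => Finset.mem_range.2 (Nat.mod_lt k hq)) _).symm
  have hsub : {ω | u ≤ |∑ k ∈ Finset.range l, F k ω|} ⊆
      ⋃ r ∈ Finset.range q, {ω | u / q ≤ |∑ k ∈ c r, F k ω|} := by
    intro ω hω
    by_contra hcon
    simp only [Set.mem_iUnion, not_exists, Set.mem_ofPred_eq, not_le] at hcon hω
    have : |∑ k ∈ Finset.range l, F k ω| < u := by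
      rw [hsum]
      calc _ ≤ ∑ r ∈ Finset.range q, |∑ k ∈ c r, F k ω| := Finset.abs_sum_le_sum_abs _ _
        _ < ∑ r ∈ Finset.range q, u / q :=
            Finset.sum_lt_sum_of_nonempty (by simpa using hq.ne') fun r hr => hcon r hr
        _ = u := by simp; field_simp
    linarith
  have hclass : ∀ r ∈ Finset.range q, P.real {ω | u / q ≤ |∑ k ∈ c r, F k ω|} ≤ B := by
    intro r _
    have hmp := fun k : ℕ => measurePreserving_past he hind hlaw (b + (k : ℕ))
    have h := measureReal_abs_sum_ge_le_fukNagaev (P := P) (ι := c r) (p := p) (s := s)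
      (N := 2 * m / q) (y := u / q) (Y := fun k => F k) hp hs0 (by positivity) (by positivity)
      (by rw [Fintype.card_coe]; exact card_filter_mod_le hq hqm hl r)
      (fun k => hf.comp (hmp k).measurable)
      (iIndepFun_past_of_modEq he hind hf hdep b (c r) r
        (fun k hk => (Finset.mem_filter.1 hk).2))
      (fun k => by
        have := integral_map (μ := P) (hmp k).measurable.aemeasurable
          (f := f) hf.aestronglyMeasurable
        rw [(hmp k).map_eq, hf0] at this
        exact this.symm)
      (fun k => by
        have := eLpNorm_comp_measurePreserving (p := ENNReal.ofReal p)
          hf.aestronglyMeasurable (hmp k)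
        exact this.trans_le hs)
    have heq : ∀ ω, ∑ k : c r, F k ω = ∑ k ∈ c r, F k ω := fun ω =>
      Finset.sum_coe_sort (c r) (fun k => F k ω)
    simp only [heq] at h
    exact h
  calc _ ≤ P.real (⋃ r ∈ Finset.range q, {ω | u / q ≤ |∑ k ∈ c r, F k ω|}) :=
        measureReal_mono hsub (measure_ne_top _ _)
    _ ≤ ∑ r ∈ Finset.range q, P.real {ω | u / q ≤ |∑ k ∈ c r, F k ω|} :=
        measureReal_biUnion_finset_le _ _
    _ ≤ ∑ r ∈ Finset.range q, B := Finset.sum_le_sum hclass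
    _ = q * B := by simp

end iid

/-! ### Fuk–Nagaev inequality under polynomial dependence. -/

lemma summable_natCast_add_one_rpow {r : ℝ} (hr : r < -1) :
    Summable fun j : ℕ => ((j : ℝ) + 1) ^ r := by
  have := (summable_nat_add_iff (f := fun n : ℕ => (n : ℝ) ^ r) 1).2
    (Real.summable_nat_rpow.2 hr)
  simpa using this

lemma one_le_tsum_natCast_add_one_rpow {r : ℝ} (hr : r < -1) :
    1 ≤ ∑' j : ℕ, ((j : ℝ) + 1) ^ r := by
  have := (summable_natCast_add_one_rpow hr).le_tsum 0 fun j _ => by positivity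
  simpa using this

lemma max_one_rpow_neg_le {a : ℝ} (ha : 0 ≤ a) (j : ℕ) :
    (max (j : ℝ) 1) ^ (-a) ≤ 2 ^ a * ((j : ℝ) + 1) ^ (-a) := by
  have h1 : (0 : ℝ) < max (j : ℝ) 1 := lt_max_of_lt_right one_pos
  have h2 : (j : ℝ) + 1 ≤ 2 * max (j : ℝ) 1 := by
    linarith [le_max_left (j : ℝ) 1, le_max_right (j : ℝ) 1]
  rw [Real.rpow_neg h1.le, Real.rpow_neg (by positivity), ← div_eq_mul_inv, inv_eq_one_div,
    div_le_div_iff₀ (by positivity) (by positivity), one_mul, ← Real.mul_rpow (by norm_num) h1.le]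
  gcongr

/-- Arithmetic of the bound for a single level of the martingale decomposition. -/
lemma level_bound {p a B κ y m q : ℝ} (ha : 5 / 2 < a) (hB : 0 < B) (hκ : 0 < κ)
    (hy : 0 < y) (hq : 1 ≤ q) (hqm : q ≤ m) {K : ℝ} (hK : 0 ≤ K) :
    q * (K * ((2 * m / q) * (B * q ^ (-a)) ^ p / (κ * y * q ^ (-(5 / 4) : ℝ) / q) ^ p +
        Real.exp (-((κ * y * q ^ (-(5 / 4) : ℝ) / q) ^ 2 /
          (4 * (2 * m / q) * (B * q ^ (-a)) ^ 2))))) ≤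
      K * (2 * (B / κ) ^ p) * (m / y ^ p) * q ^ (-(p * (a - 9 / 4))) +
        K * m * Real.exp (-(κ ^ 2 / (8 * B ^ 2) * y ^ 2 / m)) := by
  have hq0 : 0 < q := by linarith
  have hm0 : 0 < m := by linarith
  -- The level's share `q ^ (-5/4)` of the threshold is divided among `q` classes. The heavy term is
  -- then of order `q ^ (-p (a - 9/4))`, and the Gaussian exponent gains `q ^ (2a - 7/2) ≥ 1`, so it
  -- is no worse than at `q = 1`.
  have e1 : κ * y * q ^ (-(5 / 4) : ℝ) / q = κ * y * q ^ (-(9 / 4) : ℝ) := by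
    rw [mul_div_assoc]
    congr 1
    nth_rewrite 2 [← Real.rpow_one q]
    rw [← Real.rpow_sub hq0]; norm_num
  rw [e1, mul_add, mul_add]
  refine add_le_add (le_of_eq ?_) ?_
  · have e2 : q ^ (-(p * (a - 9 / 4))) = q ^ (-a * p) / q ^ (-(9 / 4) * p : ℝ) := by
      rw [← Real.rpow_sub hq0]; congr 1; ring
    rw [Real.mul_rpow hB.le (by positivity), Real.mul_rpow (by positivity) (by positivity),
      Real.mul_rpow hκ.le hy.le, ← Real.rpow_mul hq0.le, ← Real.rpow_mul hq0.le,
      Real.div_rpow hB.le hκ.le, e2]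
    field_simp
  · have e3 : κ ^ 2 / (8 * B ^ 2) * y ^ 2 / m ≤
        (κ * y * q ^ (-(9 / 4) : ℝ)) ^ 2 / (4 * (2 * m / q) * (B * q ^ (-a)) ^ 2) := by
      have e4 : (κ * y * q ^ (-(9 / 4) : ℝ)) ^ 2 / (4 * (2 * m / q) * (B * q ^ (-a)) ^ 2) =
          (κ ^ 2 / (8 * B ^ 2) * y ^ 2 / m) * (q * (q ^ (-(9 / 4) : ℝ)) ^ 2 / (q ^ (-a)) ^ 2) := by
        field_simp; ring
      have e5 : q * (q ^ (-(9 / 4) : ℝ)) ^ 2 / (q ^ (-a)) ^ 2 = q ^ (2 * a - 7 / 2) := by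
        rw [← Real.rpow_natCast, ← Real.rpow_natCast, ← Real.rpow_mul hq0.le,
          ← Real.rpow_mul hq0.le]
        nth_rewrite 1 [← Real.rpow_one q]
        rw [← Real.rpow_add hq0, ← Real.rpow_sub hq0]
        congr 1; push_cast; ring
      rw [e4, e5]
      exact le_mul_of_one_le_right (by positivity) (Real.one_le_rpow hq (by linarith))
    calc q * (K * Real.exp (-((κ * y * q ^ (-(9 / 4) : ℝ)) ^ 2 /
          (4 * (2 * m / q) * (B * q ^ (-a)) ^ 2))))
        ≤ m * (K * Real.exp (-(κ ^ 2 / (8 * B ^ 2) * y ^ 2 / m))) := by gcongr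
      _ = _ := by ring

/-- Shows that `m` summands, each with the tail norm beyond level `m`, have a total norm bounded
independently of `m`. -/
lemma mul_tsum_rpow_tail_le {a : ℝ} (ha : 2 < a) {m : ℕ} (hm : 1 ≤ m) :
    (m : ℝ) * ∑' i : ℕ, ((m + i : ℕ) + 1 : ℝ) ^ (-a) ≤ ∑' i : ℕ, ((i : ℝ) + 1) ^ (1 - a) := by
  have hs1 : Summable fun i : ℕ => ((m + i : ℕ) + 1 : ℝ) ^ (-a) := by
    have := (summable_nat_add_iff (f := fun n : ℕ => ((n : ℝ) + 1) ^ (-a)) m).2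
      (summable_natCast_add_one_rpow (by linarith))
    simpa only [add_comm] using this
  rw [← tsum_mul_left]
  refine Summable.tsum_le_tsum (fun i => ?_) (hs1.mul_left _)
    (summable_natCast_add_one_rpow (by linarith))
  have h0 : (0 : ℝ) < ((m + i : ℕ) + 1 : ℝ) := by positivity
  calc (m : ℝ) * ((m + i : ℕ) + 1 : ℝ) ^ (-a)
      ≤ ((m + i : ℕ) + 1 : ℝ) * ((m + i : ℕ) + 1 : ℝ) ^ (-a) := by
        gcongr; push_cast; linarith [(Nat.cast_nonneg i : (0:ℝ) ≤ i)]
    _ = ((m + i : ℕ) + 1 : ℝ) ^ (1 - a) := by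
        rw [sub_eq_add_neg, Real.rpow_add h0, Real.rpow_one]
    _ ≤ ((i : ℝ) + 1) ^ (1 - a) :=
        Real.rpow_le_rpow_of_nonpos (by positivity)
          (by push_cast; linarith [(Nat.cast_nonneg m : (0:ℝ) ≤ m)]) (by linarith)

/-- Fuk–Nagaev inequality for causal processes with polynomially decaying dependence. -/
theorem exists_fukNagaev_past {p a A : ℝ} (hp : 4 < p) (ha : 5 / 2 < a) (hA : 0 < A) :
    ∃ C c : ℝ, 0 < C ∧ 0 < c ∧ ∀ {Ω 𝕊 : Type*} [MeasurableSpace Ω] [MeasurableSpace 𝕊]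
      {P : Measure Ω} [IsProbabilityMeasure P] {ν : Measure 𝕊} [IsProbabilityMeasure ν]
      {e : ℤ → Ω → 𝕊} {g : (ℕ → 𝕊) → ℝ},
      (∀ k, Measurable (e k)) → iIndepFun e P → (∀ k, P.map (e k) = ν) → Measurable g →
      Integrable g (iidLaw ν) → ∫ x, g x ∂(iidLaw ν) = 0 →
      (∀ j : ℕ, eLpNorm (fun w : (ℕ → 𝕊) × 𝕊 => g w.1 - g (Function.update w.1 j w.2))
        (ENNReal.ofReal p) ((iidLaw ν).prod ν) ≤
          ENNReal.ofReal (A * (max (j : ℝ) 1) ^ (-a))) →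
      ∀ (b : ℤ) (l m : ℕ), 1 ≤ m → l ≤ m → ∀ y : ℝ, 0 < y →
        P.real {ω | y ≤ |∑ k ∈ Finset.range l, g (past (fun i => e i ω) (b + (k : ℕ)))|} ≤
          C * (m / y ^ p) + C * m ^ 2 * Real.exp (-(c * y ^ 2 / m)) := by
  have hp0 : 0 < p := by linarith
  have ha2 : 2 < a := by linarith
  have hr1 : (-(5 / 4) : ℝ) < -1 := by norm_num
  -- Here `p > 4` meets `a > 5/2`: `p (a - 9/4) > 4 · 1/4`, so the heavy terms are summable over
  -- levels.
  have hr2 : -(p * (a - 9 / 4)) < -1 := by nlinarith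
  have hr3 : 1 - a < -1 := by linarith
  set B : ℝ := A * 2 ^ a with hB
  have hB0 : 0 < B := by positivity
  set Z₁ : ℝ := ∑' j : ℕ, ((j : ℝ) + 1) ^ (-(5 / 4) : ℝ) with hZ₁
  set Z₂ : ℝ := ∑' j : ℕ, ((j : ℝ) + 1) ^ (-(p * (a - 9 / 4))) with hZ₂
  set Z₃ : ℝ := ∑' j : ℕ, ((j : ℝ) + 1) ^ (1 - a) with hZ₃
  have h1 : 1 ≤ Z₁ := one_le_tsum_natCast_add_one_rpow hr1
  have h2 : 1 ≤ Z₂ := one_le_tsum_natCast_add_one_rpow hr2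
  have h3 : 1 ≤ Z₃ := one_le_tsum_natCast_add_one_rpow hr3
  -- Normalised so that the level thresholds `u j` sum to at most `y / 2`; the other half is left to
  -- the remainder.
  set κ : ℝ := 1 / (2 * Z₁) with hκ
  have hκ0 : 0 < κ := by positivity
  set K : ℝ := 2 * fukNagaevConst p with hKdef
  have hK0 : 0 < K := by have := one_le_fukNagaevConst hp0.le; positivity
  refine ⟨K * (2 * (B / κ) ^ p) * Z₂ + (2 * (B * Z₃)) ^ p + K, κ ^ 2 / (8 * B ^ 2),
    by positivity, by positivity, ?_⟩
  intro Ω 𝕊 _ _ P _ ν _ e g he hind hlaw hg hi h0 hdep b l m hm hl y hy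
  have hm0 : (0 : ℝ) < m := by exact_mod_cast hm
  have hmp := fun k : ℕ => measurePreserving_past he hind hlaw (b + (k : ℕ))
  have hdep' : ∀ j : ℕ,
      eLpNorm (fun w : (ℕ → 𝕊) × 𝕊 => g w.1 - g (Function.update w.1 j w.2))
        (ENNReal.ofReal p) ((iidLaw ν).prod ν) ≤ ENNReal.ofReal (B * ((j : ℝ) + 1) ^ (-a)) := by
    intro j
    refine (hdep j).trans (ENNReal.ofReal_le_ofReal ?_)
    rw [hB, mul_assoc]
    gcongr
    exact max_one_rpow_neg_le (by linarith) j
  set X : ℕ → ℕ → Ω → ℝ := fun j k ω => headDiff ν g j (past (fun i => e i ω) (b + (k : ℕ))) with hX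
  set R : ℕ → Ω → ℝ := fun k ω => g (past (fun i => e i ω) (b + (k : ℕ))) -
    headMean ν g m (past (fun i => e i ω) (b + (k : ℕ))) with hR
  set u : ℕ → ℝ := fun j => κ * y * ((j : ℝ) + 1) ^ (-(5 / 4) : ℝ) with hu
  have hu0 : ∀ j, 0 < u j := fun j => by positivity
  have husum : ∑ j ∈ Finset.range m, u j ≤ y / 2 := by
    calc ∑ j ∈ Finset.range m, u j
        = κ * y * ∑ j ∈ Finset.range m, ((j : ℝ) + 1) ^ (-(5 / 4) : ℝ) := by
          rw [Finset.mul_sum]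
      _ ≤ κ * y * Z₁ := by
          gcongr
          exact (summable_natCast_add_one_rpow hr1).sum_le_tsum _ fun j _ => by positivity
      _ = y / 2 := by rw [hκ]; field_simp
  have hdec : ∀ ω, ∑ k ∈ Finset.range l, g (past (fun i => e i ω) (b + (k : ℕ))) =
      ∑ j ∈ Finset.range m, ∑ k ∈ Finset.range l, X j k ω + ∑ k ∈ Finset.range l, R k ω := by
    intro ω
    rw [Finset.sum_comm, ← Finset.sum_add_distrib]
    refine Finset.sum_congr rfl fun k _ => ?_
    simp only [hX, hR]
    rw [sum_headDiff h0]
    ring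
  have hsub : {ω | y ≤ |∑ k ∈ Finset.range l, g (past (fun i => e i ω) (b + (k : ℕ)))|} ⊆
      (⋃ j ∈ Finset.range m, {ω | u j ≤ |∑ k ∈ Finset.range l, X j k ω|}) ∪
        {ω | y / 2 ≤ |∑ k ∈ Finset.range l, R k ω|} := by
    intro ω hω
    by_contra hcon
    simp only [Set.mem_union, Set.mem_iUnion, not_or, not_exists, Set.mem_ofPred_eq,
      not_le] at hcon hω
    obtain ⟨hc1, hc2⟩ := hcon
    rw [hdec] at hω
    have hc3 : |∑ j ∈ Finset.range m, ∑ k ∈ Finset.range l, X j k ω| ≤ y / 2 :=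
      (Finset.abs_sum_le_sum_abs _ _).trans
        ((Finset.sum_le_sum fun j hj => (hc1 j hj).le).trans husum)
    linarith [abs_add_le (∑ j ∈ Finset.range m, ∑ k ∈ Finset.range l, X j k ω)
      (∑ k ∈ Finset.range l, R k ω)]
  set E : ℝ := Real.exp (-(κ ^ 2 / (8 * B ^ 2) * y ^ 2 / m)) with hE
  have hE0 : 0 < E := Real.exp_pos _
  have hlev : ∀ j ∈ Finset.range m, P.real {ω | u j ≤ |∑ k ∈ Finset.range l, X j k ω|} ≤
      K * (2 * (B / κ) ^ p) * (m / y ^ p) * ((j : ℝ) + 1) ^ (-(p * (a - 9 / 4))) + K * m * E := by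
    intro j hj
    have hjm : j + 1 ≤ m := Finset.mem_range.1 hj
    have h := measureReal_abs_sum_past_ge_le (P := P) he hind hlaw (p := p)
      (s := B * ((j : ℝ) + 1) ^ (-a)) (u := u j) (by linarith) (by positivity) (hu0 j)
      (Nat.succ_pos j) hjm hl (measurable_headDiff hg j)
      (fun x x' hx => headDiff_congr hx) (integral_headDiff hg hi j)
      ((eLpNorm_headDiff_le (by linarith) hg hi j).trans (hdep' j)) b
    refine h.trans ?_
    simp only [Nat.succ_eq_add_one, Nat.cast_add, Nat.cast_one]
    exact level_bound ha hB0 hκ0 hy (by linarith [(Nat.cast_nonneg j : (0:ℝ) ≤ j)])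
      (by exact_mod_cast hjm) hK0.le
  have hRm : ∀ k, AEStronglyMeasurable (R k) P := fun k =>
    ((hg.sub (measurable_headMean hg m)).comp (hmp k).measurable).aestronglyMeasurable
  -- The remainder has norm bounded uniformly in `m` without any independence, so Markov suffices.
  have hRn : eLpNorm (fun ω => ∑ k ∈ Finset.range l, R k ω) (ENNReal.ofReal p) P ≤
      ENNReal.ofReal (B * Z₃) := by
    have hk : ∀ k, eLpNorm (R k) (ENNReal.ofReal p) P ≤
        ENNReal.ofReal (B * ∑' i : ℕ, ((m + i : ℕ) + 1 : ℝ) ^ (-a)) := by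
      intro k
      have h4 := eLpNorm_comp_measurePreserving (p := ENNReal.ofReal p)
        (hg.sub (measurable_headMean (ν := ν) hg m)).aestronglyMeasurable (hmp k)
      refine h4.trans_le ((eLpNorm_sub_headMean_le (by linarith) hg hi hdep' m).trans ?_)
      have hs1 : Summable fun i : ℕ => ((m + i : ℕ) + 1 : ℝ) ^ (-a) := by
        have := (summable_nat_add_iff (f := fun n : ℕ => ((n : ℝ) + 1) ^ (-a)) m).2
          (summable_natCast_add_one_rpow (by linarith))
        simpa only [add_comm] using this
      rw [← tsum_mul_left, ENNReal.ofReal_tsum_of_nonneg (fun i => by positivity)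
        (hs1.mul_left _)]
    have heq : (fun ω => ∑ k ∈ Finset.range l, R k ω) = ∑ k ∈ Finset.range l, R k := by
      ext ω; simp
    rw [heq]
    calc eLpNorm (∑ k ∈ Finset.range l, R k) (ENNReal.ofReal p) P
        ≤ ∑ k ∈ Finset.range l, eLpNorm (R k) (ENNReal.ofReal p) P :=
          eLpNorm_sum_le (fun k _ => hRm k) (by
            rw [← ENNReal.ofReal_one]; exact ENNReal.ofReal_le_ofReal (by linarith))
      _ ≤ ∑ k ∈ Finset.range l, ENNReal.ofReal (B * ∑' i : ℕ, ((m + i : ℕ) + 1 : ℝ) ^ (-a)) :=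
          Finset.sum_le_sum fun k _ => hk k
      _ = ENNReal.ofReal (l * (B * ∑' i : ℕ, ((m + i : ℕ) + 1 : ℝ) ^ (-a))) := by
          rw [Finset.sum_const, Finset.card_range, nsmul_eq_mul,
            ENNReal.ofReal_mul (Nat.cast_nonneg l), ENNReal.ofReal_natCast]
      _ ≤ ENNReal.ofReal (B * Z₃) := by
          refine ENNReal.ofReal_le_ofReal ?_
          have h5 := mul_tsum_rpow_tail_le ha2 hm
          have h6 : (0 : ℝ) ≤ ∑' i : ℕ, ((m + i : ℕ) + 1 : ℝ) ^ (-a) :=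
            tsum_nonneg fun i => by positivity
          have h7 : (l : ℝ) ≤ m := by exact_mod_cast hl
          calc (l : ℝ) * (B * ∑' i : ℕ, ((m + i : ℕ) + 1 : ℝ) ^ (-a))
              ≤ m * (B * ∑' i : ℕ, ((m + i : ℕ) + 1 : ℝ) ^ (-a)) := by gcongr
            _ = B * (m * ∑' i : ℕ, ((m + i : ℕ) + 1 : ℝ) ^ (-a)) := by ring
            _ ≤ B * Z₃ := by gcongr
  have hRp : P.real {ω | y / 2 ≤ |∑ k ∈ Finset.range l, R k ω|} ≤
      (2 * (B * Z₃)) ^ p * (m / y ^ p) := by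
    have h8 := measureReal_abs_ge_le_of_eLpNorm_le (P := P) hp0 (by positivity : 0 ≤ B * Z₃)
      (by positivity : 0 < y / 2)
      (Finset.aestronglyMeasurable_fun_sum _ fun k _ => hRm k) hRn
    refine h8.trans ?_
    rw [Real.div_rpow hy.le (by norm_num),
      Real.mul_rpow (x := 2) (y := B * Z₃) (by norm_num) (by positivity)]
    have h9 : (1 : ℝ) ≤ m := by exact_mod_cast hm
    calc (B * Z₃) ^ p / (y ^ p / 2 ^ p) = 2 ^ p * (B * Z₃) ^ p * (1 / y ^ p) := by field_simp
      _ ≤ _ := by gcongr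
  calc _ ≤ _ := measureReal_mono hsub (measure_ne_top _ _)
    _ ≤ P.real (⋃ j ∈ Finset.range m, {ω | u j ≤ |∑ k ∈ Finset.range l, X j k ω|}) +
        P.real {ω | y / 2 ≤ |∑ k ∈ Finset.range l, R k ω|} := measureReal_union_le _ _
    _ ≤ ∑ j ∈ Finset.range m, (K * (2 * (B / κ) ^ p) * (m / y ^ p) *
          ((j : ℝ) + 1) ^ (-(p * (a - 9 / 4))) + K * m * E) +
          (2 * (B * Z₃)) ^ p * (m / y ^ p) :=
        add_le_add ((measureReal_biUnion_finset_le _ _).trans (Finset.sum_le_sum hlev)) hRp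
    _ ≤ (K * (2 * (B / κ) ^ p) * (m / y ^ p) * Z₂ + m * (K * m * E)) +
          (2 * (B * Z₃)) ^ p * (m / y ^ p) := by
        rw [Finset.sum_add_distrib, ← Finset.mul_sum, Finset.sum_const, Finset.card_range,
          nsmul_eq_mul]
        gcongr
        exact (summable_natCast_add_one_rpow hr2).sum_le_tsum _ fun j _ => by positivity
    _ ≤ _ := by
        have t1 : 0 ≤ K * (m / y ^ p) := by positivity
        have t2 : 0 ≤ (K * (2 * (B / κ) ^ p) * Z₂ + (2 * (B * Z₃)) ^ p) * m ^ 2 * E := by positivity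
        linarith

/-! ### Transfer to the noise of the model. -/

/-- For an array independent of `d`, every entry eventually enters the maximum. Hence the limsup in
the dependence measure controls each single coordinate. -/
lemma le_supStar_const {α : Type*} [CompleteLattice α] (c : ℕ → α) (h : ℕ) :
    c h ≤ supStar fun _ h => c h := by
  refine le_limsup_of_frequently_le' (Eventually.frequently ?_)
  filter_upwards [eventually_gt_atTop h] with d hd
  exact le_iSup (fun i : Fin d => c i) ⟨h, hd⟩

namespace ChangePointModel

set_option linter.unusedSectionVars false

variable {Ω 𝕊 : Type*}

/-- The partial sums `∑_{j ≤ k} U_{j,h}` of the noise. -/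
noncomputable def noiseSum (M : ChangePointModel Ω 𝕊) (h k : ℕ) (ω : Ω) : ℝ :=
  ∑ j ∈ Finset.Icc 1 k, M.noise j h ω

lemma noiseSum_zero (M : ChangePointModel Ω 𝕊) (h : ℕ) (ω : Ω) : M.noiseSum h 0 ω = 0 := by
  simp [noiseSum]

lemma noiseSum_sub (M : ChangePointModel Ω 𝕊) (h : ℕ) {i k : ℕ} (hik : i ≤ k) (ω : Ω) :
    M.noiseSum h k ω - M.noiseSum h i ω =
      ∑ r ∈ Finset.range (k - i), M.noise ((i : ℤ) + 1 + (r : ℕ)) h ω := by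
  obtain ⟨n, rfl⟩ := Nat.exists_eq_add_of_le hik
  rw [Nat.add_sub_cancel_left]
  induction n with
  | zero => simp
  | succ n ih =>
    rw [Finset.sum_range_succ, ← ih (Nat.le_add_right i n), noiseSum, noiseSum, noiseSum,
      ← add_assoc, Finset.sum_Icc_succ_top (by omega)]
    push_cast
    rw [add_right_comm (i : ℤ) n 1]
    ring

variable [MeasurableSpace Ω] [MeasurableSpace 𝕊] {P : Measure Ω} [IsProbabilityMeasure P]
  {M : ChangePointModel Ω 𝕊}

lemma IsRegular.map_innov (hM : M.IsRegular P) (k : ℤ) :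
    P.map (M.innov k) = P.map (M.innov 0) := (hM.identDistrib k).map_eq

lemma IsRegular.measurePreserving_past (hM : M.IsRegular P) (k : ℤ) :
    MeasurePreserving (fun ω => past (fun i => M.innov i ω) k) P
      (iidLaw (P.map (M.innov 0))) := by
  have : IsProbabilityMeasure (P.map (M.innov 0)) :=
    Measure.isProbabilityMeasure_map (hM.measurable_innov 0).aemeasurable
  exact _root_.measurePreserving_past hM.measurable_innov hM.indep hM.map_innov k

lemma IsRegular.integrable_g (hM : M.IsRegular P) (h : ℕ) :
    Integrable (M.g h) (iidLaw (P.map (M.innov 0))) :=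
  ((hM.measurePreserving_past 0).integrable_comp
    (hM.measurable_g h).aestronglyMeasurable).1 (hM.integrable 0 h)

lemma IsRegular.integral_g (hM : M.IsRegular P) (h : ℕ) :
    ∫ x, M.g h x ∂(iidLaw (P.map (M.innov 0))) = 0 := by
  rw [← (hM.measurePreserving_past 0).map_eq,
    integral_map (hM.measurePreserving_past 0).measurable.aemeasurable
      (hM.measurable_g h).aestronglyMeasurable]
  exact hM.centered 0 h

/-- Seen from time `k`, the innovation at time `0` is coordinate `k` of the past, so replacing it by
a copy is an update there. -/
lemma IsRegular.eLpNorm_update_le_depMeasure (hM : M.IsRegular P) (p : ℝ) (h k : ℕ) :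
    eLpNorm (fun w : (ℕ → 𝕊) × 𝕊 => M.g h w.1 - M.g h (Function.update w.1 k w.2))
        (ENNReal.ofReal p) ((iidLaw (P.map (M.innov 0))).prod (P.map (M.innov 0))) ≤
      M.depMeasure P p k := by
  have hpr : IsProbabilityMeasure (P.map (M.innov 0)) :=
    Measure.isProbabilityMeasure_map (hM.measurable_innov 0).aemeasurable
  have hmp := (hM.measurePreserving_past k).prod
    (⟨hM.measurable_innov 0, rfl⟩ : MeasurePreserving (M.innov 0) P (P.map (M.innov 0)))
  have hH : Measurable
      (fun w : (ℕ → 𝕊) × 𝕊 => M.g h w.1 - M.g h (Function.update w.1 k w.2)) :=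
    ((hM.measurable_g h).comp measurable_fst).sub
      ((hM.measurable_g h).comp (measurable_update_prod k))
  rw [← eLpNorm_comp_measurePreserving hH.aestronglyMeasurable hmp]
  refine le_trans (le_of_eq ?_) (le_supStar_const (fun h => eLpNorm
    (fun w : Ω × Ω =>
      M.g h (past (fun i => M.innov i w.1) k) -
        M.g h (past (fun i => if i = 0 then M.innov 0 w.2 else M.innov i w.1) k))
    (ENNReal.ofReal p) (P.prod P)) h)
  congr 1
  ext w
  simp only [Function.comp_apply, Prod.map_fst, Prod.map_snd]
  congr 2
  ext j
  simp only [past, Function.update_apply]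
  have : (k : ℤ) - j = 0 ↔ j = k := by omega
  simp only [this]

/-- Fuk–Nagaev inequality for the increments of the partial sums of the noise. -/
theorem exists_fukNagaev_noiseSum {p a A : ℝ} (hp : 4 < p) (ha : 5 / 2 < a) (hA : 0 < A) :
    ∃ C c : ℝ, 0 < C ∧ 0 < c ∧ ∀ {Ω 𝕊 : Type*} [MeasurableSpace Ω] [MeasurableSpace 𝕊]
      {P : Measure Ω} [IsProbabilityMeasure P] {M : ChangePointModel Ω 𝕊},
      M.IsRegular P → M.TemporalAssumptions P p a A →
      ∀ h i k m : ℕ, 1 ≤ m → k ≤ i + m → i ≤ k + m → ∀ y : ℝ, 0 < y →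
        P.real {ω | y ≤ |M.noiseSum h k ω - M.noiseSum h i ω|} ≤
          C * (m / y ^ p) + C * m ^ 2 * Real.exp (-(c * y ^ 2 / m)) := by
  obtain ⟨C, c, hC, hc, H⟩ := exists_fukNagaev_past hp ha hA
  refine ⟨C, c, hC, hc, ?_⟩
  intro Ω 𝕊 _ _ P _ M hM hT h i k m hm hki hik y hy
  have hpr : IsProbabilityMeasure (P.map (M.innov 0)) :=
    Measure.isProbabilityMeasure_map (hM.measurable_innov 0).aemeasurable
  have key : ∀ i k : ℕ, i ≤ k → k ≤ i + m →
      P.real {ω | y ≤ |M.noiseSum h k ω - M.noiseSum h i ω|} ≤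
          C * (m / y ^ p) + C * m ^ 2 * Real.exp (-(c * y ^ 2 / m)) := by
    intro i k hik hki
    simp only [M.noiseSum_sub h hik]
    exact H hM.measurable_innov hM.indep hM.map_innov (hM.measurable_g h) (hM.integrable_g h)
      (hM.integral_g h) (fun j => (hM.eLpNorm_update_le_depMeasure p h j).trans (hT.decay j))
      _ _ _ hm (by omega) y hy
  rcases le_total i k with h1 | h1
  · exact key i k h1 hki
  · simpa only [abs_sub_comm] using key k i h1 hik

end ChangePointModel

/-! ### Deterministic analysis of the argmax. -/

/-- The CUSUM of a unit jump at `κ`, evaluated at `k`. -/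
noncomputable def tent (n κ k : ℝ) : ℝ := if k ≤ κ then k * (n - κ) / n else κ * (n - k) / n

lemma tent_nonneg {n κ k : ℝ} (hn : 0 < n) (hκ0 : 0 ≤ κ) (hκ : κ ≤ n) (hk0 : 0 ≤ k)
    (hk : k ≤ n) : 0 ≤ tent n κ k := by
  unfold tent
  split_ifs
  · exact div_nonneg (mul_nonneg hk0 (by linarith)) hn.le
  · exact div_nonneg (mul_nonneg hκ0 (by linarith)) hn.le

/-- The two slopes are `(n - κ) / n` and `-κ / n`, both at least `c` in absolute value. -/
lemma tent_peak_sub_ge {n κ k c : ℝ} (hn : 0 < n) (h1 : c * n ≤ κ) (h2 : c * n ≤ n - κ) :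
    c * |k - κ| ≤ tent n κ κ - tent n κ k := by
  have e0 : tent n κ κ = κ * (n - κ) / n := by simp [tent]
  rw [e0]
  unfold tent
  split_ifs with h
  · rw [abs_of_nonpos (by linarith), ← sub_div, le_div_iff₀ hn]
    nlinarith
  · rw [abs_of_pos (by linarith), ← sub_div, le_div_iff₀ hn]
    nlinarith

lemma tent_peak_sub_le {n κ k : ℝ} (hn : 0 < n) (h1 : 0 ≤ κ) (h2 : κ ≤ n) :
    tent n κ κ - tent n κ k ≤ |k - κ| := by
  have e0 : tent n κ κ = κ * (n - κ) / n := by simp [tent]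
  rw [e0]
  unfold tent
  split_ifs with h
  · rw [abs_of_nonpos (by linarith), ← sub_div, div_le_iff₀ hn]
    nlinarith
  · rw [abs_of_pos (by linarith), ← sub_div, div_le_iff₀ hn]
    nlinarith

/-- The value at the competitor either keeps the sign of the drift, so only a noise difference can
compensate, or has flipped it, so the noise must beat both drifts together. -/
lemma abs_le_abs_dichotomy {d b b' w w' : ℝ} (h : |d * b' + w'| ≤ |d * b + w|) :
    |d| * (b' - b) ≤ |w - w'| ∨ |d| * (b' + b) ≤ |w - w'| + 2 * |w'| := by
  have h1 := neg_abs_le (d * b' + w')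
  have h2 := le_abs_self (d * b' + w')
  have h3 := neg_abs_le (w - w')
  have h4 := le_abs_self (w - w')
  have h5 := neg_abs_le w'
  have h6 := le_abs_self w'
  rcases abs_choice d with hd | hd <;> rcases abs_choice (d * b + w) with hv | hv <;>
    rw [hd] <;> rw [hv] at h
  · left; linarith
  · right; linarith
  · right; linarith
  · left; linarith

/-- If the CUSUM at `k` is at least the CUSUM at a point `k'` next to the change point `κ`, and `k`
is far from `k'`, then the noise has a large increment. -/
lemma noise_large_of_cusum_le {t n κ k k' d Sk Sk' Sn : ℝ} (ht : 0 < t) (ht1 : t ≤ 1 / 2)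
    (hn : 0 < n) (hκ : t * n / 2 ≤ κ) (hκ' : t * n ≤ n - κ) (hk0 : 0 ≤ k) (hk : k ≤ n)
    (hk0' : 0 ≤ k') (hk' : k' ≤ n) (hkκ : |k' - κ| ≤ 1) (hL : 4 / t ^ 2 + 2 ≤ |k - k'|)
    (hV : |d * tent n κ k' + (Sk' - k' / n * Sn)| ≤ |d * tent n κ k + (Sk - k / n * Sn)|) :
    t ^ 2 / 24 * |d| * |k - k'| ≤ |Sk - Sk'| ∨ t ^ 2 / 24 * |d| * n ≤ |Sn| ∨
      t ^ 2 / 24 * |d| * n ≤ |Sk'| := by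
  have hd := abs_nonneg d
  have hκn : κ ≤ n := by nlinarith
  have hκ0 : 0 ≤ κ := by nlinarith
  have hLn : |k - k'| ≤ n := abs_le.2 ⟨by linarith, by linarith⟩
  have ht2 : t ^ 2 * (4 / t ^ 2 + 2) = 4 + 2 * t ^ 2 := by field_simp
  have hL2 : 4 + 2 * t ^ 2 ≤ t ^ 2 * |k - k'| := by rw [← ht2]; gcongr
  -- This margin absorbs the distance at most `1` between `k'` and the true peak `κ`, at the cost of
  -- halving the slope in `g6`.
  have hL1 : 4 ≤ t * |k - k'| - 2 * t := by nlinarith [abs_nonneg (k - k')]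
  have g1 : t / 2 * |k - κ| ≤ tent n κ κ - tent n κ k :=
    tent_peak_sub_ge hn (by linarith) (by nlinarith)
  have g2 := tent_peak_sub_le (k := k') hn hκ0 hκn
  have g3 := tent_nonneg hn hκ0 hκn hk0 hk
  have g4 : t ^ 2 * n / 2 ≤ tent n κ κ := by
    have e0 : tent n κ κ = κ * (n - κ) / n := by simp [tent]
    rw [e0, le_div_iff₀ hn]
    have : t * n / 2 * (t * n) ≤ κ * (n - κ) := by gcongr
    nlinarith
  have g5 : |k - k'| ≤ |k - κ| + 1 := by
    have := abs_sub_le k κ k'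
    rw [abs_sub_comm κ k'] at this
    linarith
  have g6 : t / 4 * |k - k'| ≤ tent n κ k' - tent n κ k := by nlinarith
  have g7 : t ^ 2 * n / 4 ≤ tent n κ k' := by nlinarith
  have hW : |(Sk - k / n * Sn) - (Sk' - k' / n * Sn)| ≤ |Sk - Sk'| + |k - k'| / n * |Sn| := by
    have : (Sk - k / n * Sn) - (Sk' - k' / n * Sn) = (Sk - Sk') - (k - k') / n * Sn := by ring
    rw [this]
    refine (abs_sub _ _).trans_eq ?_
    rw [abs_mul, abs_div, abs_of_pos hn]
  have hr1 : |k - k'| / n ≤ 1 := (div_le_one hn).2 hLn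
  -- If all three alternatives fail, the flipped-sign case bounds the noise by six terms, each at
  -- most `t ^ 2 / 24 * |d| * n`. Their sum is `t ^ 2 * |d| * n / 4`, exactly the drift in `g7`;
  -- this fixes the constant `24`.
  by_contra hcon
  push Not at hcon
  obtain ⟨c1, c2, c3⟩ := hcon
  have c4 : |k - k'| / n * |Sn| ≤ t ^ 2 / 24 * |d| * |k - k'| := by
    calc |k - k'| / n * |Sn| ≤ |k - k'| / n * (t ^ 2 / 24 * |d| * n) := by gcongr
      _ = _ := by field_simp
  have c5 : t ^ 2 / 24 * |d| * |k - k'| ≤ t ^ 2 / 24 * |d| * n := by gcongr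
  have hdL : 0 ≤ |d| * |k - k'| := by positivity
  have htt : t ^ 2 ≤ t := by nlinarith
  rcases abs_le_abs_dichotomy hV with h | h
  · have h1 : |d| * (t / 4 * |k - k'|) ≤ |d| * (tent n κ k' - tent n κ k) := by gcongr
    have h2 : t ^ 2 * (|d| * |k - k'|) ≤ t * (|d| * |k - k'|) := by gcongr
    have h3 : 0 ≤ t * (|d| * |k - k'|) := by positivity
    linarith
  · have h1 : |d| * (t ^ 2 * n / 4) ≤ |d| * (tent n κ k' + tent n κ k) := by
      gcongr; linarith
    have h2 : |Sk' - k' / n * Sn| ≤ |Sk'| + |Sn| := by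
      refine (abs_sub _ _).trans ?_
      rw [abs_mul, abs_div, abs_of_pos hn, abs_of_nonneg hk0']
      have : k' / n * |Sn| ≤ 1 * |Sn| := by
        gcongr; exact (div_le_one hn).2 hk'
      linarith
    linarith

namespace ChangePointModel

variable {Ω 𝕊 : Type*} {M : ChangePointModel Ω 𝕊}

lemma ChangeAt.sum_mean {n h : ℕ} (hc : M.ChangeAt n h) {k : ℕ} (hk : k ≤ n) :
    ∑ j ∈ Finset.Icc 1 k, M.mean n j h =
      if k ≤ M.changeTime n h then k * M.mean n (M.changeTime n h) h
      else M.changeTime n h * M.mean n (M.changeTime n h) h +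
        ((k : ℝ) - M.changeTime n h) * M.mean n (M.changeTime n h + 1) h := by
  obtain ⟨-, -, -, -, h1, h2, -⟩ := hc
  induction k with
  | zero => simp
  | succ k ih =>
    rw [Finset.sum_Icc_succ_top (by omega), ih (by omega)]
    rcases lt_trichotomy k (M.changeTime n h) with hlt | heq | hgt
    · rw [if_pos hlt.le, if_pos (by omega), h1 (k + 1) (Finset.mem_Icc.2 ⟨by omega, by omega⟩)]
      push_cast; ring
    · rw [if_pos heq.le, if_neg (by omega), heq]
      push_cast; ring
    · rw [if_neg (by omega), if_neg (by omega), h2 (k + 1) (Finset.mem_Icc.2 ⟨by omega, hk⟩)]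
      push_cast; ring

lemma ChangeAt.cusum_eq {n h : ℕ} (hc : M.ChangeAt n h) (ω : Ω) {t : ℝ} (ht : t ≤ 1) :
    M.cusum n h ω t = (n : ℝ) ^ (-(1 / 2) : ℝ) *
      |(M.mean n (M.changeTime n h) h - M.mean n (M.changeTime n h + 1) h) *
          tent n (M.changeTime n h) ⌈n * t⌉₊ +
        (M.noiseSum h ⌈n * t⌉₊ ω - (⌈n * t⌉₊ : ℝ) / n * M.noiseSum h n ω)| := by
  have hκ1 := hc.2.2.1
  have hκn := hc.2.2.2.1
  have hn : (0 : ℝ) < n := by exact_mod_cast (by omega : 0 < n)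
  have hk : ⌈n * t⌉₊ ≤ n := Nat.ceil_le.2 (by nlinarith)
  have hsum : ∀ k, ∑ j ∈ Finset.Icc 1 k, M.obs n j h ω =
      ∑ j ∈ Finset.Icc 1 k, M.mean n j h + M.noiseSum h k ω := fun k => by
    simp only [obs, noiseSum, Finset.sum_add_distrib]
  unfold cusum
  rw [hsum, hsum, hc.sum_mean hk, hc.sum_mean le_rfl, if_neg (by omega : ¬ n ≤ _)]
  congr 2
  unfold tent
  simp only [Nat.cast_le]
  split_ifs <;> field_simp <;> ring

/-- A large estimation error forces a large increment of the partial sums of the noise. -/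
lemma ChangeAt.noise_large {𝔱 : ℝ} (h𝔱 : 0 < 𝔱) (h𝔱' : 𝔱 ≤ 1 / 2) {n h : ℕ}
    (hc : M.ChangeAt n h) (hτ : 𝔱 < M.frac n h ∧ M.frac n h < 1 - 𝔱) {ω : Ω} {s x : ℝ}
    (hs : M.IsArgmaxCusum 𝔱 n h ω s) (hx : 4 / 𝔱 ^ 2 + 3 ≤ n * x)
    (hsx : x ≤ |s - M.frac n h|) :
    (∃ k ≤ n, n * x - 1 ≤ |(k : ℝ) - ⌈n * M.frac n h⌉₊| ∧
      𝔱 ^ 2 / 24 * M.jump n h * |(k : ℝ) - ⌈n * M.frac n h⌉₊| ≤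
        |M.noiseSum h k ω - M.noiseSum h ⌈n * M.frac n h⌉₊ ω|) ∨
    𝔱 ^ 2 / 24 * M.jump n h * n ≤ |M.noiseSum h n ω - M.noiseSum h 0 ω| ∨
    𝔱 ^ 2 / 24 * M.jump n h * n ≤ |M.noiseSum h ⌈n * M.frac n h⌉₊ ω - M.noiseSum h 0 ω| := by
  have hκ1 := hc.2.2.1
  have hκn := hc.2.2.2.1
  have hn : (0 : ℝ) < n := by exact_mod_cast (by omega : 0 < n)
  set τ := M.frac n h with hτdef
  have hτ0 : 0 < τ := by linarith
  obtain ⟨⟨hs1, hs2⟩, hmax⟩ := hs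
  have hs0 : 0 < s := by linarith
  set k := ⌈n * s⌉₊ with hk
  set k' := ⌈n * τ⌉₊ with hk'
  set κ := M.changeTime n h with hκ
  have hκdef : κ = ⌊n * τ⌋₊ := by rw [hκ, changeTime, mul_comm]
  have hkn : k ≤ n := Nat.ceil_le.2 (by nlinarith)
  have hkn' : k' ≤ n := Nat.ceil_le.2 (by nlinarith)
  have a1 := Nat.le_ceil (n * s)
  have a2 := Nat.ceil_lt_add_one (by positivity : 0 ≤ n * s)
  have a3 := Nat.le_ceil (n * τ)
  have a4 := Nat.ceil_lt_add_one (by positivity : 0 ≤ n * τ)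
  rw [← hk] at a1 a2
  rw [← hk'] at a3 a4
  have a5 := Nat.floor_le (by positivity : 0 ≤ n * τ)
  have a6 := Nat.lt_floor_add_one (n * τ)
  rw [← hκdef] at a5 a6
  have b1 : κ ≤ k' := by
    have : (κ : ℝ) ≤ k' := a5.trans a3
    exact_mod_cast this
  -- The CUSUM at `τ` rounds `n * τ` up while the change time rounds it down, so the reference index
  -- may miss the peak by one.
  have b2 : k' ≤ κ + 1 := by
    have : (k' : ℝ) < (κ + 2 : ℕ) := by push_cast; linarith
    have : k' < κ + 2 := by exact_mod_cast this
    omega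
  have b1' : (κ : ℝ) ≤ k' := by exact_mod_cast b1
  have b2' : (k' : ℝ) ≤ κ + 1 := by exact_mod_cast b2
  have hκ1' : (1 : ℝ) ≤ κ := by exact_mod_cast hκ1
  have hV := hmax (show τ ∈ Set.Ioo 𝔱 (1 - 𝔱) from hτ)
  simp only [Set.mem_ofPred_eq] at hV
  rw [hc.cusum_eq ω (by linarith : τ ≤ 1), hc.cusum_eq ω (by linarith : s ≤ 1)] at hV
  have hV' := le_of_mul_le_mul_left hV (Real.rpow_pos_of_pos hn _)
  have hLx : n * x - 1 ≤ |(k : ℝ) - k'| := by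
    have c1 : n * |s - τ| ≤ |(k : ℝ) - k'| + 1 := by
      have c0 : n * |s - τ| = |n * (s - τ)| := by rw [abs_mul, abs_of_pos hn]
      rw [c0]
      rcases abs_cases (n * (s - τ)) with h | h <;> rcases abs_cases ((k : ℝ) - k') with h' | h' <;>
        nlinarith
    have c2 : n * x ≤ n * |s - τ| := by gcongr
    linarith
  -- The hypothesis `𝔱 * n / 2 ≤ κ` holds because `κ ≥ 1` gives `n * τ < κ + 1 ≤ 2 * κ`.
  have key := noise_large_of_cusum_le h𝔱 h𝔱' hn (κ := κ) (by nlinarith) (by nlinarith)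
    (Nat.cast_nonneg k) (by exact_mod_cast hkn) (Nat.cast_nonneg k') (by exact_mod_cast hkn')
    (abs_le.2 ⟨by linarith, by linarith⟩) (by linarith) hV'
  simp only [noiseSum_zero, sub_zero]
  rcases key with h1 | h1 | h1
  · exact Or.inl ⟨k, hkn, hLx, h1⟩
  · exact Or.inr (Or.inl h1)
  · exact Or.inr (Or.inr h1)

end ChangePointModel

/-! ### Union bound over increments. -/

/-- Factor out `k ^ (3 - p)`, which dominates `d ^ (3 - p)`, and sum the inverse squares. -/
lemma sum_Icc_rpow_one_sub_le {p : ℝ} (hp : 3 ≤ p) {k : ℕ} (hk : 1 ≤ k) (n : ℕ) :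
    ∑ d ∈ Finset.Icc k n, (d : ℝ) ^ (1 - p) ≤ 2 * (k : ℝ) ^ (2 - p) := by
  have hk0 : (0 : ℝ) < k := by exact_mod_cast hk
  have h1 : Finset.Icc k n = Finset.Ioo (k - 1) (n + 1) := by
    ext d; simp only [Finset.mem_Icc, Finset.mem_Ioo]; omega
  calc ∑ d ∈ Finset.Icc k n, (d : ℝ) ^ (1 - p)
      ≤ ∑ d ∈ Finset.Icc k n, (k : ℝ) ^ (3 - p) * ((d : ℝ) ^ 2)⁻¹ := by
        refine Finset.sum_le_sum fun d hd => ?_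
        have hkd : (k : ℝ) ≤ d := by exact_mod_cast (Finset.mem_Icc.1 hd).1
        have hd0 : (0 : ℝ) < d := hk0.trans_le hkd
        calc (d : ℝ) ^ (1 - p) = (d : ℝ) ^ (3 - p) * ((d : ℝ) ^ 2)⁻¹ := by
              rw [← Real.rpow_natCast, ← Real.rpow_neg hd0.le, ← Real.rpow_add hd0]
              congr 1; push_cast; ring
          _ ≤ _ := by
              gcongr ?_ * _
              exact Real.rpow_le_rpow_of_nonpos hk0 hkd (by linarith)
    _ = (k : ℝ) ^ (3 - p) * ∑ d ∈ Finset.Ioo (k - 1) (n + 1), ((d : ℝ) ^ 2)⁻¹ := by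
        rw [← Finset.mul_sum, h1]
    _ ≤ (k : ℝ) ^ (3 - p) * (2 / k) := by
        gcongr
        have := sum_Ioo_inv_sq_le (α := ℝ) (k - 1) (n + 1)
        rwa [Nat.cast_sub hk, Nat.cast_one, sub_add_cancel] at this
    _ = 2 * (k : ℝ) ^ (2 - p) := by
        have : (k : ℝ) ^ (3 - p) = (k : ℝ) ^ (2 - p) * k := by
          rw [← Real.rpow_add_one hk0.ne']; congr 1; ring
        rw [this]; field_simp

/-- The polynomial part of the Fuk–Nagaev bound in terms of the rate `X log n`. -/
lemma heavy_bound {p r X l : ℝ} (hp : 0 < p) (hX : 0 < X) (hl0 : 0 < l)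
    {K : ℝ} (hK : 0 < K) (hr : 0 < r) (h : K * l ≤ r ^ 2 * X) :
    (r ^ p)⁻¹ * X ^ (2 - p) ≤ K ^ (-(p / 2)) * (l ^ 2)⁻¹ * (X * l) ^ (-p / 2 + 2) := by
  -- Turns `r ^ (-p)` into a power of `X / l`; the surplus `l ^ (-2)` is later bounded by its value
  -- at `n = 2`.
  have h1 : K * l / X ≤ r ^ 2 := by rwa [div_le_iff₀ hX]
  have h2 : (K * l / X) ^ (p / 2) ≤ r ^ p := by
    calc (K * l / X) ^ (p / 2) ≤ (r ^ 2) ^ (p / 2) := by gcongr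
      _ = r ^ p := by
        rw [← Real.rpow_natCast, ← Real.rpow_mul hr.le]; congr 1; push_cast; ring
  calc (r ^ p)⁻¹ * X ^ (2 - p) ≤ ((K * l / X) ^ (p / 2))⁻¹ * X ^ (2 - p) := by gcongr
    _ = K ^ (-(p / 2)) * (l ^ (-(p / 2)) * (X ^ (p / 2) * X ^ (2 - p))) := by
        rw [Real.div_rpow (by positivity) hX.le, Real.mul_rpow hK.le hl0.le,
          Real.rpow_neg hK.le, Real.rpow_neg hl0.le]
        field_simp
    _ = K ^ (-(p / 2)) * ((l ^ 2)⁻¹ * l ^ (-p / 2 + 2) * X ^ (-p / 2 + 2)) := by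
        have e1 : X ^ (p / 2) * X ^ (2 - p) = X ^ (-p / 2 + 2) := by
          rw [← Real.rpow_add hX]; congr 1; ring
        have e2 : (l ^ 2)⁻¹ * l ^ (-p / 2 + 2) = l ^ (-(p / 2)) := by
          rw [← Real.rpow_natCast, ← Real.rpow_neg hl0.le, ← Real.rpow_add hl0]
          congr 1; push_cast; ring
        rw [e1, e2]
    _ = _ := by rw [Real.mul_rpow hX.le hl0.le]; ring

/-- Union bound over all increments starting at a given point. -/
lemma measureReal_increment_le {Ω : Type*} [MeasurableSpace Ω] {P : Measure Ω}
    [IsProbabilityMeasure P] {S : ℕ → Ω → ℝ} {p C c r X : ℝ} (hp : 4 < p) (hC : 0 < C)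
    (hc : 0 < c) (hr : 0 < r) {n k' : ℕ} (hn : 2 ≤ n) (hk' : k' ≤ n)
    (H : ∀ i k m : ℕ, 1 ≤ m → k ≤ i + m → i ≤ k + m → ∀ y : ℝ, 0 < y →
      P.real {ω | y ≤ |S k ω - S i ω|} ≤
        C * (m / y ^ p) + C * m ^ 2 * Real.exp (-(c * y ^ 2 / m)))
    (hX : 2 ≤ X) (hXn : X ≤ n) (hrX : 2 * p / c * Real.log n ≤ r ^ 2 * X) :
    P.real {ω | (∃ k ≤ n, X - 1 ≤ |(k : ℝ) - k'| ∧ r * |(k : ℝ) - k'| ≤ |S k ω - S k' ω|) ∨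
        r * n ≤ |S n ω - S 0 ω| ∨ r * n ≤ |S k' ω - S 0 ω|} ≤
      C * (6 * 2 ^ (p - 2) * (2 * p / c) ^ (-(p / 2)) * ((Real.log 2) ^ 2)⁻¹ + 4) *
        (X * Real.log n) ^ (-p / 2 + 2) := by
  have hn0 : (0 : ℝ) < n := by exact_mod_cast (by omega : 0 < n)
  have hn2 : (2 : ℝ) ≤ n := by exact_mod_cast hn
  have hl2 : 0 < Real.log 2 := Real.log_pos (by norm_num)
  have hl : Real.log 2 ≤ Real.log n := Real.log_le_log (by norm_num) hn2
  have hl0 : 0 < Real.log n := hl2.trans_le hl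
  have hX0 : 0 < X := by linarith
  set D₀ : ℕ := ⌈X - 1⌉₊ with hD₀
  have hD : X / 2 ≤ D₀ := by linarith [Nat.le_ceil (X - 1)]
  have hD1 : 1 ≤ D₀ := Nat.one_le_ceil_iff.2 (by linarith)
  have hterm : ∀ d : ℕ, D₀ ≤ d → d ≤ n →
      C * ((d : ℝ) / (r * d) ^ p) + C * (d : ℝ) ^ 2 * Real.exp (-(c * (r * d) ^ 2 / d)) ≤
        C * (r ^ p)⁻¹ * (d : ℝ) ^ (1 - p) + C * (n : ℝ) ^ (2 - p) := by
    intro d hd hdn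
    have hdX : X / 2 ≤ d := hD.trans (by exact_mod_cast hd)
    have hd0 : (0 : ℝ) < d := by linarith
    have hdn' : (d : ℝ) ≤ n := by exact_mod_cast hdn
    refine add_le_add (le_of_eq ?_) ?_
    · rw [Real.mul_rpow hr.le hd0.le, Real.rpow_sub hd0, Real.rpow_one]; field_simp
    · have e1 : p * Real.log n ≤ c * (r * d) ^ 2 / d := by
        have e2 : c * (r * d) ^ 2 / d = c * (r ^ 2 * d) := by field_simp
        have e3 : r ^ 2 * (X / 2) ≤ r ^ 2 * d := by gcongr
        have e4 : c * (2 * p / c * Real.log n) ≤ c * (2 * (r ^ 2 * d)) :=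
          mul_le_mul_of_nonneg_left (by linarith) hc.le
        have e5 : c * (2 * p / c * Real.log n) = 2 * (p * Real.log n) := by field_simp
        rw [e2]; linarith
      have e6 : Real.exp (-(c * (r * d) ^ 2 / d)) ≤ (n : ℝ) ^ (-p) := by
        rw [Real.rpow_def_of_pos hn0]
        refine Real.exp_le_exp.2 ?_
        linarith
      calc C * (d : ℝ) ^ 2 * Real.exp (-(c * (r * d) ^ 2 / d))
          ≤ C * (n : ℝ) ^ 2 * (n : ℝ) ^ (-p) := by gcongr
        _ = C * (n : ℝ) ^ (2 - p) := by
          rw [mul_assoc, ← Real.rpow_natCast, ← Real.rpow_add hn0]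
          congr 2
  have hsub : {ω | (∃ k ≤ n, X - 1 ≤ |(k : ℝ) - k'| ∧
        r * |(k : ℝ) - k'| ≤ |S k ω - S k' ω|) ∨
        r * n ≤ |S n ω - S 0 ω| ∨ r * n ≤ |S k' ω - S 0 ω|} ⊆
      (⋃ d ∈ Finset.Icc D₀ n, ({ω | r * d ≤ |S (k' + d) ω - S k' ω|} ∪
        {ω | r * d ≤ |S (k' - d) ω - S k' ω|})) ∪
        ({ω | r * n ≤ |S n ω - S 0 ω|} ∪ {ω | r * n ≤ |S k' ω - S 0 ω|}) := by
    rintro ω (⟨k, hk, h1, h2⟩ | h)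
    · left
      simp only [Set.mem_iUnion, Set.mem_union, Set.mem_ofPred_eq, Finset.mem_Icc]
      rcases le_total k' k with hle | hle
      · have e : |(k : ℝ) - k'| = ((k - k' : ℕ) : ℝ) := by
          rw [Nat.cast_sub hle, abs_of_nonneg (by rw [sub_nonneg]; exact_mod_cast hle)]
        rw [e] at h1 h2
        refine ⟨k - k', ⟨Nat.ceil_le.2 h1, by omega⟩, Or.inl ?_⟩
        rwa [Nat.add_sub_cancel' hle]
      · have e : |(k : ℝ) - k'| = ((k' - k : ℕ) : ℝ) := by
          rw [abs_sub_comm, Nat.cast_sub hle,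
            abs_of_nonneg (by rw [sub_nonneg]; exact_mod_cast hle)]
        rw [e] at h1 h2
        refine ⟨k' - k, ⟨Nat.ceil_le.2 h1, by omega⟩, Or.inr ?_⟩
        rwa [Nat.sub_sub_self hle]
    · exact Or.inr h
  have hD₀n : D₀ ≤ n := Nat.ceil_le.2 (by linarith)
  have hB : ∀ i k d : ℕ, D₀ ≤ d → d ≤ n → k ≤ i + d → i ≤ k + d →
      P.real {ω | r * d ≤ |S k ω - S i ω|} ≤
        C * (r ^ p)⁻¹ * (d : ℝ) ^ (1 - p) + C * (n : ℝ) ^ (2 - p) := by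
    intro i k d hd hdn h1 h2
    have hd0 : (0 : ℝ) < d := by exact_mod_cast (by omega : 0 < d)
    exact (H i k d (by omega) h1 h2 (r * d) (by positivity)).trans (hterm d hd hdn)
  have hcard : ((Finset.Icc D₀ n).card : ℝ) ≤ n := by
    rw [Nat.card_Icc]; exact_mod_cast (by omega : n + 1 - D₀ ≤ n)
  have hXn2 : (n : ℝ) ^ (1 - p) ≤ (X / 2) ^ (2 - p) := by
    calc (n : ℝ) ^ (1 - p) ≤ (n : ℝ) ^ (2 - p) :=
          Real.rpow_le_rpow_of_exponent_le (by linarith) (by linarith)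
      _ ≤ (X / 2) ^ (2 - p) :=
          Real.rpow_le_rpow_of_nonpos (by positivity) (by linarith) (by linarith)
  have hsumD : ∑ d ∈ Finset.Icc D₀ n, (d : ℝ) ^ (1 - p) ≤ 2 * (X / 2) ^ (2 - p) := by
    refine (sum_Icc_rpow_one_sub_le (by linarith) hD1 n).trans ?_
    gcongr ?_ * ?_
    exact Real.rpow_le_rpow_of_nonpos (by positivity) hD (by linarith)
  -- The exponent is negative and both `X` and `log n` are at most `n`, so the right side is at
  -- least `(n * n) ^ (2 - p / 2) = n ^ (4 - p)`.
  have hlight : (n : ℝ) * (n : ℝ) ^ (2 - p) ≤ (X * Real.log n) ^ (-p / 2 + 2) := by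
    have hln : Real.log n ≤ n := (Real.log_le_sub_one_of_pos hn0).trans (by linarith)
    calc (n : ℝ) * (n : ℝ) ^ (2 - p) = (n : ℝ) ^ (3 - p) := by
          rw [mul_comm, ← Real.rpow_add_one hn0.ne']; congr 1; ring
      _ ≤ (n : ℝ) ^ (4 - p) :=
          Real.rpow_le_rpow_of_exponent_le (by linarith) (by linarith)
      _ = ((n : ℝ) * n) ^ (-p / 2 + 2) := by
          rw [Real.mul_rpow hn0.le hn0.le, ← Real.rpow_add hn0]; congr 1; ring
      _ ≤ _ := Real.rpow_le_rpow_of_nonpos (by positivity) (by gcongr) (by linarith)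
  have hlight2 : (n : ℝ) ^ (2 - p) ≤ (n : ℝ) * (n : ℝ) ^ (2 - p) :=
    le_mul_of_one_le_left (by positivity) (by linarith)
  have hheavy := heavy_bound (by linarith : 0 < p) hX0 hl0 (by positivity : 0 < 2 * p / c) hr hrX
  have hX2 : (X / 2) ^ (2 - p) = 2 ^ (p - 2) * X ^ (2 - p) := by
    rw [Real.div_rpow hX0.le (by norm_num), div_eq_mul_inv, ← Real.rpow_neg (by norm_num),
      neg_sub, mul_comm]
  have hlog : ((Real.log n) ^ 2)⁻¹ ≤ ((Real.log 2) ^ 2)⁻¹ := by gcongr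
  set W := (X * Real.log n) ^ (-p / 2 + 2) with hW
  have hW0 : 0 ≤ W := by positivity
  calc _ ≤ _ := measureReal_mono hsub (measure_ne_top _ _)
    _ ≤ ∑ d ∈ Finset.Icc D₀ n, 2 * (C * (r ^ p)⁻¹ * (d : ℝ) ^ (1 - p) + C * (n : ℝ) ^ (2 - p)) +
        2 * (C * (r ^ p)⁻¹ * (n : ℝ) ^ (1 - p) + C * (n : ℝ) ^ (2 - p)) := by
        refine (measureReal_union_le _ _).trans (add_le_add ?_ ?_)
        · refine (measureReal_biUnion_finset_le _ _).trans (Finset.sum_le_sum fun d hd => ?_)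
          obtain ⟨hd1, hd2⟩ := Finset.mem_Icc.1 hd
          refine (measureReal_union_le _ _).trans ?_
          rw [two_mul]
          exact add_le_add (hB k' (k' + d) d hd1 hd2 le_rfl (by omega))
            (hB k' (k' - d) d hd1 hd2 (by omega) (by omega))
        · refine (measureReal_union_le _ _).trans ?_
          rw [two_mul]
          exact add_le_add (hB 0 n n hD₀n le_rfl (by omega) (by omega))
            (hB 0 k' n hD₀n le_rfl (by omega) (by omega))
    _ = 2 * (C * (r ^ p)⁻¹) * ∑ d ∈ Finset.Icc D₀ n, (d : ℝ) ^ (1 - p) +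
        2 * C * ((Finset.Icc D₀ n).card * (n : ℝ) ^ (2 - p)) +
        2 * (C * (r ^ p)⁻¹ * (n : ℝ) ^ (1 - p) + C * (n : ℝ) ^ (2 - p)) := by
        rw [← Finset.mul_sum, Finset.sum_add_distrib, ← Finset.mul_sum, Finset.sum_const,
          nsmul_eq_mul]
        ring
    _ ≤ 2 * (C * (r ^ p)⁻¹) * (2 * (X / 2) ^ (2 - p)) + 2 * C * (n * (n : ℝ) ^ (2 - p)) +
        2 * (C * (r ^ p)⁻¹ * (X / 2) ^ (2 - p) + C * (n * (n : ℝ) ^ (2 - p))) := by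
        gcongr
    _ = C * (6 * 2 ^ (p - 2)) * ((r ^ p)⁻¹ * X ^ (2 - p)) +
        4 * C * (n * (n : ℝ) ^ (2 - p)) := by rw [hX2]; ring
    _ ≤ C * (6 * 2 ^ (p - 2)) * ((2 * p / c) ^ (-(p / 2)) * ((Real.log 2) ^ 2)⁻¹ * W) +
        4 * C * W := by
        refine add_le_add (mul_le_mul_of_nonneg_left (hheavy.trans ?_) (by positivity)) (by gcongr)
        gcongr
    _ = _ := by ring

/-! ### From one coordinate to the maximal error. -/

namespace ChangePointModel

variable {Ω 𝕊 : Type*} {M : ChangePointModel Ω 𝕊}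

lemma mem_changeSet {n h : ℕ} : h ∈ M.changeSet n ↔ h < M.dim n ∧ M.ChangeAt n h := by
  classical
  simp [changeSet]

lemma jump_pos {n h : ℕ} (hc : M.ChangeAt n h) : 0 < M.jump n h :=
  abs_pos.2 (sub_ne_zero.2 hc.2.2.2.2.2.2)

lemma minJump_le_jump {n h : ℕ} (hh : h ∈ M.changeSet n) : M.minJump n ≤ M.jump n h :=
  ciInf_le (f := fun h : M.changeSet n => M.jump n h) (Set.finite_range _).bddBelow ⟨h, hh⟩

lemma minJump_pos {n : ℕ} (hn : (M.changeSet n).Nonempty) : 0 < M.minJump n := by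
  have : Nonempty (M.changeSet n) := hn.to_subtype
  obtain ⟨h, hh⟩ := exists_eq_ciInf_of_finite (f := fun h : M.changeSet n => M.jump n h)
  rw [minJump, ← hh]
  exact jump_pos (mem_changeSet.1 h.2).2

lemma maxError_nonneg (τhat : ℕ → ℕ → Ω → ℝ) (n : ℕ) (ω : Ω) : 0 ≤ M.maxError τhat n ω :=
  Real.iSup_nonneg fun _ => abs_nonneg _

lemma exists_le_of_le_maxError {τhat : ℕ → ℕ → Ω → ℝ} {n : ℕ} {ω : Ω} {x : ℝ}
    (hn : (M.changeSet n).Nonempty) (hx : x ≤ M.maxError τhat n ω) :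
    ∃ h ∈ M.changeSet n, x ≤ |τhat n h ω - M.frac n h| := by
  have : Nonempty (M.changeSet n) := hn.to_subtype
  obtain ⟨h, hh⟩ := exists_eq_ciSup_of_finite
    (f := fun h : M.changeSet n => |τhat n h ω - M.frac n h|)
  exact ⟨h, h.2, by rw [hh]; exact hx⟩

variable [MeasurableSpace Ω] {P : Measure Ω} [IsProbabilityMeasure P]

/-- Deviation bound for the estimator of a single change point. -/
lemma ChangeAt.measureReal_error_ge_le {p 𝔱 C c δ x : ℝ} (hp : 4 < p) (h𝔱 : 0 < 𝔱)
    (h𝔱' : 𝔱 ≤ 1 / 2) (hC : 0 < C) (hc : 0 < c) {n h : ℕ} (hn : 2 ≤ n)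
    (hch : M.ChangeAt n h) (hτ : 𝔱 < M.frac n h ∧ M.frac n h < 1 - 𝔱)
    (H : ∀ i k m : ℕ, 1 ≤ m → k ≤ i + m → i ≤ k + m → ∀ y : ℝ, 0 < y →
      P.real {ω | y ≤ |M.noiseSum h k ω - M.noiseSum h i ω|} ≤
        C * (m / y ^ p) + C * m ^ 2 * Real.exp (-(c * y ^ 2 / m)))
    {s : Ω → ℝ} (hs : ∀ ω, M.IsArgmaxCusum 𝔱 n h ω (s ω)) (hδ : 0 < δ) (hδj : δ ≤ M.jump n h)
    (hx : 2 * p / (c * (𝔱 ^ 2 / 24) ^ 2) * (Real.log n / (δ ^ 2 * n)) ≤ x)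
    (hnx : 4 / 𝔱 ^ 2 + 3 ≤ n * x) :
    P.real {ω | x ≤ |s ω - M.frac n h|} ≤
      C * (6 * 2 ^ (p - 2) * (2 * p / c) ^ (-(p / 2)) * ((Real.log 2) ^ 2)⁻¹ + 4) *
        (x * n * Real.log n) ^ (-p / 2 + 2) := by
  have hn0 : (0 : ℝ) < n := by exact_mod_cast (by omega : 0 < n)
  have hl0 : 0 < Real.log n := Real.log_pos (by exact_mod_cast (by omega : 1 < n))
  have hl2 : 0 < Real.log 2 := Real.log_pos (by norm_num)
  have hx0 : 0 < x := lt_of_lt_of_le (by positivity) hx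
  -- For `x > 1` the event is empty, since both fractions lie in `(0, 1)`; otherwise `n * x ≤ n`, as
  -- the increment bound requires.
  rcases lt_or_ge 1 x with h1 | h1
  · have : {ω | x ≤ |s ω - M.frac n h|} = ∅ := by
      refine Set.eq_empty_of_forall_notMem fun ω hω => ?_
      obtain ⟨⟨hs1, hs2⟩, -⟩ := hs ω
      have h2 : |s ω - M.frac n h| < 1 := abs_lt.2 ⟨by linarith, by linarith⟩
      exact absurd (h1.trans_le hω) (not_lt.2 h2.le)
    rw [this, measureReal_empty]
    positivity
  · have hk' : ⌈n * M.frac n h⌉₊ ≤ n := Nat.ceil_le.2 (by nlinarith [hτ.2])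
    have hXn : (n : ℝ) * x ≤ n := by nlinarith
    have h4 : (0 : ℝ) ≤ 4 / 𝔱 ^ 2 := by positivity
    have hrX : 2 * p / c * Real.log n ≤ (𝔱 ^ 2 / 24 * δ) ^ 2 * (n * x) := by
      have e : 2 * p / c * Real.log n = (𝔱 ^ 2 / 24 * δ) ^ 2 * (n *
          (2 * p / (c * (𝔱 ^ 2 / 24) ^ 2) * (Real.log n / (δ ^ 2 * n)))) := by field_simp
      rw [e]; gcongr
    have key := measureReal_increment_le (P := P) hp hC hc (by positivity : 0 < 𝔱 ^ 2 / 24 * δ)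
      hn hk' H (by linarith) hXn hrX
    rw [mul_comm x (n : ℝ)]
    refine le_trans (measureReal_mono ?_ (measure_ne_top _ _)) key
    intro ω hω
    have hle : ∀ z : ℝ, 0 ≤ z → 𝔱 ^ 2 / 24 * δ * z ≤ 𝔱 ^ 2 / 24 * M.jump n h * z :=
      fun z hz => by gcongr
    rcases hch.noise_large h𝔱 h𝔱' hτ (hs ω) hnx hω with ⟨k, hk, h2, h3⟩ | h3 | h3
    · exact Or.inl ⟨k, hk, h2, (hle _ (abs_nonneg _)).trans h3⟩
    · exact Or.inr (Or.inl ((hle _ hn0.le).trans h3))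
    · exact Or.inr (Or.inr ((hle _ hn0.le).trans h3))

/-- For `x` of order `1/n` the sample size is bounded, and the deviation bound is trivial. -/
lemma one_le_of_small {p K c₀ D δ x : ℝ} (hp : 4 < p) (hK : 0 < K) (hc₀ : 0 < c₀) (hδ : 0 < δ)
    (hδD : δ ≤ D) {n : ℕ} (hn : 2 ≤ n) (hx : K * (Real.log n / (δ ^ 2 * n)) ≤ x)
    (hnx : n * x < c₀) :
    1 ≤ (c₀ ^ 2 * D ^ 2 / K) ^ (p / 2 - 2) * (x * n * Real.log n) ^ (-p / 2 + 2) := by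
  have hn0 : (0 : ℝ) < n := by exact_mod_cast (by omega : 0 < n)
  have hl0 : 0 < Real.log n := Real.log_pos (by exact_mod_cast (by omega : 1 < n))
  have hx0 : 0 < x := lt_of_lt_of_le (by positivity) hx
  have h1 : K * Real.log n ≤ D ^ 2 * c₀ := by
    calc K * Real.log n = δ ^ 2 * (n * (K * (Real.log n / (δ ^ 2 * n)))) := by field_simp
      _ ≤ δ ^ 2 * (n * x) := by gcongr
      _ ≤ D ^ 2 * c₀ := by gcongr
  have h2 : x * n * Real.log n ≤ c₀ ^ 2 * D ^ 2 / K := by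
    calc x * n * Real.log n = (n * x) * (K * Real.log n) / K := by field_simp
      _ ≤ c₀ * (D ^ 2 * c₀) / K := by gcongr
      _ = _ := by ring
  have h3 : (0 : ℝ) < x * n * Real.log n := by positivity
  calc (1 : ℝ) = (x * n * Real.log n) ^ (p / 2 - 2) * (x * n * Real.log n) ^ (-p / 2 + 2) := by
        rw [← Real.rpow_add h3, show p / 2 - 2 + (-p / 2 + 2) = 0 by ring, Real.rpow_zero]
    _ ≤ _ := by gcongr; linarith

/-- Consistency of the change point estimators from the deviation bound. -/
lemma tendstoInMeasure_maxError {p C K 𝔡 : ℝ} (hC : 0 < C) {τhat : ℕ → ℕ → Ω → ℝ}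
    {n₁ : ℕ} (h𝔡p : 𝔡 < p / 2 - 2) (h𝔡0 : 0 < 𝔡)
    (hbound : ∀ n ≥ n₁, ∀ x : ℝ, K * (Real.log n / (M.minJump n ^ 2 * n)) ≤ x →
      P.real {ω | x ≤ M.maxError τhat n ω} ≤
        C * (M.changeSet n).card * (x * n * Real.log n) ^ (-p / 2 + 2))
    (hdim : (fun n => (M.dim n : ℝ)) =O[atTop] (fun n : ℕ => (n : ℝ) ^ 𝔡))
    (hlim : Tendsto (fun n : ℕ => Real.log n / (M.minJump n ^ 2 * n)) atTop (𝓝 0)) :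
    TendstoInMeasure P (M.maxError τhat) atTop (fun _ => 0) := by
  rw [tendstoInMeasure_iff_measureReal_norm]
  intro ε hε
  obtain ⟨B, hB0, hB⟩ := hdim.exists_pos
  have hlim' : Tendsto (fun n : ℕ => K * (Real.log n / (M.minJump n ^ 2 * n))) atTop (𝓝 0) := by
    simpa using hlim.const_mul K
  have hz : Tendsto (fun n : ℕ => C * B * ε ^ (-p / 2 + 2) * (n : ℝ) ^ (-(p / 2 - 2 - 𝔡)))
      atTop (𝓝 0) := by
    simpa using ((tendsto_rpow_neg_atTop (by linarith : 0 < p / 2 - 2 - 𝔡)).comp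
      tendsto_natCast_atTop_atTop).const_mul (C * B * ε ^ (-p / 2 + 2))
  refine squeeze_zero' (Eventually.of_forall fun n => measureReal_nonneg) ?_ hz
  filter_upwards [eventually_ge_atTop n₁, eventually_ge_atTop 3, hB.bound,
    hlim'.eventually_le_const hε] with n hn hn3 hdn hle
  have hn0 : (0 : ℝ) < n := by exact_mod_cast (by omega : 0 < n)
  have hl : 1 ≤ Real.log n := by
    rw [Real.le_log_iff_exp_le hn0]
    have : (3 : ℝ) ≤ n := by exact_mod_cast hn3
    linarith [Real.exp_one_lt_d9]
  simp only [sub_zero, Real.norm_eq_abs, abs_of_nonneg (maxError_nonneg τhat n _)]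
  have hcard : ((M.changeSet n).card : ℝ) ≤ B * (n : ℝ) ^ 𝔡 := by
    have h1 : ((M.changeSet n).card : ℝ) ≤ M.dim n := by
      classical
      have : (M.changeSet n).card ≤ (Finset.range (M.dim n)).card :=
        Finset.card_le_card fun h hh => Finset.mem_range.2 (mem_changeSet.1 hh).1
      rw [Finset.card_range] at this
      exact_mod_cast this
    rw [Real.norm_of_nonneg (by positivity), Real.norm_of_nonneg (by positivity)] at hdn
    exact h1.trans hdn
  calc P.real {ω | ε ≤ M.maxError τhat n ω}
      ≤ C * (M.changeSet n).card * (ε * n * Real.log n) ^ (-p / 2 + 2) := hbound n hn ε hle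
    -- The logarithm is dropped, since it is at least `1` for `n ≥ 3` and its exponent is negative;
    -- `𝔡 < p / 2 - 2` leaves a negative power of `n`.
    _ ≤ C * (B * (n : ℝ) ^ 𝔡) * (ε * n) ^ (-p / 2 + 2) := by
        refine mul_le_mul (by gcongr) ?_ (by positivity) (by positivity)
        exact Real.rpow_le_rpow_of_nonpos (by positivity)
          (le_mul_of_one_le_right (by positivity) hl) (by linarith)
    _ = C * B * ε ^ (-p / 2 + 2) * (n : ℝ) ^ (-(p / 2 - 2 - 𝔡)) := by
        have e : (n : ℝ) ^ 𝔡 * (n : ℝ) ^ (-p / 2 + 2) = (n : ℝ) ^ (-(p / 2 - 2 - 𝔡)) := by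
          rw [← Real.rpow_add hn0]; congr 1; ring
        rw [Real.mul_rpow hε.le hn0.le, ← e]; ring

end ChangePointModel

theorem mainTheorem5 (p 𝔞 A 𝔱 : ℝ) (hp : 4 < p) (h𝔞 : 5 / 2 < 𝔞) (hA : 0 < A)
    (h𝔱 : 0 < 𝔱) (h𝔱' : 𝔱 ≤ 1 / 2) :
    ∃ Ca : ℝ, 0 < Ca ∧ ∀ D : ℝ, 0 < D → ∃ C : ℝ, 0 < C ∧
      ∀ (Ω 𝕊 : Type*) [MeasurableSpace Ω] [MeasurableSpace 𝕊]
        (P : Measure Ω) [IsProbabilityMeasure P]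
        (M : ChangePointModel Ω 𝕊) (τhat : ℕ → ℕ → Ω → ℝ) (n₁ : ℕ),
        2 ≤ n₁ →
        M.IsRegular P →
        M.TemporalAssumptions P p 𝔞 A →
        (∀ n ≥ n₁, M.Alternative n) →
        AntitoneOn M.minJump (Set.Ici n₁) →
        M.minJump n₁ ≤ D →
        (∀ n ≥ n₁, ∀ h ∈ M.changeSet n, 𝔱 < M.frac n h ∧ M.frac n h < 1 - 𝔱) →
        (∀ n ≥ n₁, ∀ h < M.dim n, ∀ ω, M.IsArgmaxCusum 𝔱 n h ω (τhat n h ω)) →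
        (∀ n ≥ n₁, ∀ x : ℝ, Ca * (Real.log n / (M.minJump n ^ 2 * n)) ≤ x →
          P.real {ω | x ≤ M.maxError τhat n ω} ≤
            C * (M.changeSet n).card * (x * n * Real.log n) ^ (-p / 2 + 2)) ∧
        (∀ 𝔡 : ℝ, 0 < 𝔡 → 𝔡 < p / 2 - 2 →
          (fun n => (M.dim n : ℝ)) =O[atTop] (fun n : ℕ => (n : ℝ) ^ 𝔡) →
          Tendsto (fun n : ℕ => Real.log n / (M.minJump n ^ 2 * n)) atTop (𝓝 0) →
          TendstoInMeasure P (M.maxError τhat) atTop (fun _ => 0)) := by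
  obtain ⟨C₁, c₁, hC₁, hc₁, H⟩ := ChangePointModel.exists_fukNagaev_noiseSum hp h𝔞 hA
  have hl2 : 0 < Real.log 2 := Real.log_pos (by norm_num)
  have hp0 : 0 < p := by linarith
  -- This is `C_a`: with `r = 𝔱 ^ 2 / 24 * Δμ`, the condition on `x` becomes `2 * p / c₁ * log n ≤ r
  -- ^ 2 * (n * x)`.
  set K : ℝ := 2 * p / (c₁ * (𝔱 ^ 2 / 24) ^ 2) with hK
  have hK0 : 0 < K := by positivity
  refine ⟨K, hK0, fun D hD => ?_⟩
  set C₂ : ℝ := C₁ * (6 * 2 ^ (p - 2) * (2 * p / c₁) ^ (-(p / 2)) * ((Real.log 2) ^ 2)⁻¹ + 4)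
    with hC₂
  have hC₂0 : 0 < C₂ := by positivity
  -- Covers `n * x < 4 / 𝔱 ^ 2 + 3`, where rounding spoils the argmax analysis. Then `x * n * log n`
  -- is bounded in terms of `D`, and the claimed bound already exceeds `1`; only here does `D`
  -- enter.
  set C₃ : ℝ := ((4 / 𝔱 ^ 2 + 3) ^ 2 * D ^ 2 / K) ^ (p / 2 - 2) with hC₃
  have hC₃0 : 0 < C₃ := by positivity
  refine ⟨C₂ + C₃, by positivity, ?_⟩
  intro Ω 𝕊 _ _ P _ M τhat n₁ hn₁ hM hT halt hanti hDn hτ hmax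
  have hbound : ∀ n ≥ n₁, ∀ x : ℝ, K * (Real.log n / (M.minJump n ^ 2 * n)) ≤ x →
      P.real {ω | x ≤ M.maxError τhat n ω} ≤
        (C₂ + C₃) * (M.changeSet n).card * (x * n * Real.log n) ^ (-p / 2 + 2) := by
    intro n hn x hx
    have hn2 : 2 ≤ n := hn₁.trans hn
    have hn0 : (0 : ℝ) < n := by exact_mod_cast (by omega : 0 < n)
    have hl0 : 0 < Real.log n := Real.log_pos (by exact_mod_cast (by omega : 1 < n))
    have hne := (halt n hn).1
    have hδ := ChangePointModel.minJump_pos hne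
    have hδD : M.minJump n ≤ D := (hanti Set.self_mem_Ici hn hn).trans hDn
    have hx0 : 0 < x := lt_of_lt_of_le (by positivity) hx
    have hcard : (1 : ℝ) ≤ (M.changeSet n).card := by exact_mod_cast hne.card_pos
    have hW : 0 ≤ (x * n * Real.log n) ^ (-p / 2 + 2) := by positivity
    rcases lt_or_ge (n * x) (4 / 𝔱 ^ 2 + 3) with hnx | hnx
    · calc P.real {ω | x ≤ M.maxError τhat n ω} ≤ 1 := measureReal_le_one
        _ ≤ C₃ * (x * n * Real.log n) ^ (-p / 2 + 2) :=
            ChangePointModel.one_le_of_small hp hK0 (by positivity) hδ hδD hn2 hx hnx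
        _ ≤ (C₂ + C₃) * (M.changeSet n).card * (x * n * Real.log n) ^ (-p / 2 + 2) := by
            gcongr
            nlinarith
    · have hsub : {ω | x ≤ M.maxError τhat n ω} ⊆
          ⋃ h ∈ M.changeSet n, {ω | x ≤ |τhat n h ω - M.frac n h|} := by
        intro ω hω
        obtain ⟨h, hh, hxh⟩ := ChangePointModel.exists_le_of_le_maxError hne hω
        simp only [Set.mem_iUnion]
        exact ⟨h, hh, hxh⟩
      calc P.real {ω | x ≤ M.maxError τhat n ω}
          ≤ ∑ h ∈ M.changeSet n, P.real {ω | x ≤ |τhat n h ω - M.frac n h|} :=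
            (measureReal_mono hsub (measure_ne_top _ _)).trans (measureReal_biUnion_finset_le _ _)
        _ ≤ ∑ h ∈ M.changeSet n, C₂ * (x * n * Real.log n) ^ (-p / 2 + 2) := by
            refine Finset.sum_le_sum fun h hh => ?_
            obtain ⟨hhd, hch⟩ := ChangePointModel.mem_changeSet.1 hh
            exact hch.measureReal_error_ge_le hp h𝔱 h𝔱' hC₁ hc₁ hn2 (hτ n hn h hh) (H hM hT h)
              (hmax n hn h hhd) hδ (ChangePointModel.minJump_le_jump hh) hx hnx
        _ = C₂ * (M.changeSet n).card * (x * n * Real.log n) ^ (-p / 2 + 2) := by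
            rw [Finset.sum_const, nsmul_eq_mul]; ring
        _ ≤ _ := by gcongr; linarith
  exact ⟨hbound, fun 𝔡 h𝔡0 h𝔡p hdim hlim =>
    ChangePointModel.tendstoInMeasure_maxError (by positivity) h𝔡p h𝔡0 hbound hdim hlim⟩
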